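/- **Theorem (commuting flows of the discrete Novikov–Veselov hierarchy).** Let $K$ be a commutative $\mathbb C$-algebra (the classical case is $K=\mathbb C$) and let $\mathcal R$ be the ring of functions $\mathbb Z^2\to K$ of $(n,m)$. Let $T_1,T_2$ be the shifts of $n$ and $m$, so that $T_\mu f=(\mathbf t_\mu f)T_\mu$ with $(\mathbf t_1f)(n,m)=f(n+1,m)$ and $(\mathbf t_2f)(n,m)=f(n,m+1)$. Put $\mathcal O_1^{\pm}=\mathcal R((T_1^{\mp1}))[T_2,T_2^{-1}]$ and $\mathcal O=\mathcal O_1^+\cap\mathcal O_1^-=\mathcal R[T_1^{\pm1},T_2^{\pm1}]$; for $H\in\mathcal O$ put $\mathcal O_H=\mathcal O H$ and $\mathcal O_H^{+}=\mathcal O_1^{+}H$. Let $\mathcal S(K)$ be the set of pairs $(H,\mathcal L)$ with $$H=T_1T_2-u(T_1-T_2)-1,\qquad \mathcal L=\sum_{s\ge 0}v_sT_1^{1-s},\qquad [H,\mathcal L]\in\mathcal O_H^+,$$ such that for some constant $C\in\mathbb C\setminus\{0\}$ and some function $\tau$ on $\mathbb Z^2$ with invertible values in $K$ $$u=C\,\frac{(\mathbf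 t_1\tau)(\mathbf t_2\tau)}{(\mathbf t_1\mathbf t_2\tau)\,\tau},\qquad v_0=\frac{(\mathbf t_1\tau)(\mathbf t_1^{-1}\tau)}{\tau^2}.$$ For $j\ge1$ write (uniquely) $\mathcal L^j=\sum_{i\le j-1}f_{ij}T_1^i(T_1-T_1^{-1})$ and put $$L_j=\Big(f_{0j}+\sum_{i=1}^{j-1}\big(f_{ij}T_1^i+T_1^{-i}f_{ij}\big)\Big)(T_1-T_1^{-1}).$$ Then the equations $$\partial_{t_j}\mathcal L=[L_j,\mathcal L],\qquad \partial_{t_j}H\equiv[L_j,H]\ \ \mathrm{mod}\ \mathcal O_H\qquad(j=1,2,\dots)$$ are well defined on $\mathcal S$ and define commuting flows on it, that is: 1. For every $x=(H,\mathcal L)\in\mathcal S(K)$ and $j\ge1$ there is exactly one tangent vector $V_j(x)=(\partial_{t_j}H,\partial_{t_j}\mathcal L)$ to $\mathcal S$ at $x$ (a pair $\xi$ with $x+\varepsilon\xi\in\mathcal S(K[\varepsilon])$, $\varepsilon^2=0$) that satisfies the $j$-th equations. 2. The vector fields commute: for every $x\in\mathcal S(K)$ and $i,j\ge1$ the coefficients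 of $\varepsilon$ in $V_i(x+\varepsilon V_j(x))$ and in $V_j(x+\varepsilon V_i(x))$ are equal. 3. For every $x\in\mathcal S(K)$ and $j\ge 1$ there is exactly one $X\in\mathcal S(K[[t]])$ with $X|_{t=0}=x$ such that $\partial_tX$ satisfies the $j$-th equations at $X$; write $X=\Phi_j^t(x)$. 4. The flows commute: $\Phi_j^t(\Phi_i^s(x))=\Phi_i^s(\Phi_j^t(x))$ for all $x\in\mathcal S(K)$ and $i,j\ge1$, as formal power series in $s,t$. -/

import Mathlib

namespace DiscreteNV

noncomputable section

/-- Functions of the two discrete variables `(n, m)`, with values in `K`. -/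
abbrev LatFun (K : Type*) := ℤ → ℤ → K

/-- Formal expressions `D = ∑ r_{ij} T₁^i T₂^j` whose coefficients `r_{ij}` are functions of
`(n, m)`; here `D i j n m` stands for `r_{ij}(n, m)`.  The rings of (pseudo-)difference operators
are cut out of this type by the conditions `IsPlus`, `IsMinus`, `IsDiff` below. -/
abbrev PDO (K : Type*) := ℤ → ℤ → LatFun K

namespace PDO

/-- `D ∈ 𝒪₁⁺ = R((T₁⁻¹))[T₂, T₂⁻¹]`. -/
def IsPlus {K : Type*} [CommRing K] (D : PDO K) : Prop :=
  (∃ N : ℤ, ∀ i j : ℤ, N < i → D i j = 0) ∧ ∃ M : ℤ, ∀ i j : ℤ, M < |j| → D i j = 0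

/-- `D ∈ 𝒪₁⁻ = R((T₁))[T₂, T₂⁻¹]`. -/
def IsMinus {K : Type*} [CommRing K] (D : PDO K) : Prop :=
  (∃ N : ℤ, ∀ i j : ℤ, i < N → D i j = 0) ∧ ∃ M : ℤ, ∀ i j : ℤ, M < |j| → D i j = 0

/-- `D ∈ 𝒪 = 𝒪₁⁺ ∩ 𝒪₁⁻ = R[T₁, T₁⁻¹, T₂, T₂⁻¹]`, the difference operators. -/
def IsDiff {K : Type*} [CommRing K] (D : PDO K) : Prop :=
  IsPlus D ∧ IsMinus D

/-- The composition of operators, `(a T₁^p T₂^q) (b T₁^k T₂^l) = a · (t₁^p t₂^q b) T₁^{p+k} T₂^{q+l}`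
where `(t₁^p t₂^q b)(n, m) = b (n + p, m + q)`.  For two operators in `𝒪₁⁺` (or two in `𝒪₁⁻`)
all the sums are finite. -/
def mul {K : Type*} [CommRing K] (a b : PDO K) : PDO K := fun i j n m =>
  ∑ᶠ p : ℤ × ℤ, a p.1 p.2 n m * b (i - p.1) (j - p.2) (n + p.1) (m + p.2)

/-- The commutator `[a, b]`. -/
def bracket {K : Type*} [CommRing K] (a b : PDO K) : PDO K := mul a b - mul b a

/-- The operator `r T₁^k T₂^l`. -/
def mono {K : Type*} [CommRing K] (r : LatFun K) (k l : ℤ) : PDO K := fun i j =>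
  if i = k ∧ j = l then r else 0

/-- The operator `∑ r_i T₁^i` that does not contain `T₂`. -/
def ofCoeffs {K : Type*} [CommRing K] (r : ℤ → LatFun K) : PDO K := fun i j =>
  if j = 0 then r i else 0

/-- Powers `D^j`. -/
def pow {K : Type*} [CommRing K] (D : PDO K) : ℕ → PDO K
  | 0 => mono 1 0 0
  | j + 1 => mul (pow D j) D

/-- `T₁ - T₁⁻¹`. -/
def T1diff (K : Type*) [CommRing K] : PDO K := mono 1 1 0 - mono 1 (-1) 0

/-- Application of a map of coefficient rings to all values of all coefficients. -/
def map {K K' : Type*} (f : K → K') (D : PDO K) : PDO K' := fun i j n m => f (D i j n m)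

/-- `D + ε E`, with coefficients in the dual numbers `K[ε]`. -/
def addEps {K : Type*} [CommRing K] (D E : PDO K) : PDO (DualNumber K) := fun i j n m =>
  TrivSqZeroExt.inl (D i j n m) + TrivSqZeroExt.inr (E i j n m)

/-- The coefficient of `ε` of an operator with coefficients in `K[ε]`. -/
def epsPart {K : Type*} [CommRing K] (D : PDO (DualNumber K)) : PDO K :=
  map TrivSqZeroExt.snd D

/-- The coefficients `f_i` of the representation `D = ∑_i f_i T₁^i (T₁ - T₁⁻¹)` of an operator
`D = ∑_i g_i T₁^i` of `𝒪₁₀⁺ = R((T₁⁻¹))`, namely `f_i = g_{i+1} + g_{i+3} + ⋯`, a finite sum;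
see `quotD_mul` and `quotD_unique`. -/
def quotD {K : Type*} [CommRing K] (D : PDO K) : ℤ → LatFun K := fun i n m =>
  ∑ᶠ l : ℕ, D (i + 1 + 2 * (l : ℤ)) 0 n m

theorem mul_T1diff {K : Type*} [CommRing K] (a : PDO K) (i j n m : ℤ) :
    mul a (T1diff K) i j n m = a (i - 1) j n m - a (i + 1) j n m := by
  unfold mul
  rw [finsum_eq_sum_of_support_subset (s := {(i - 1, j), (i + 1, j)})]
  · rw [Finset.sum_pair (by intro h; have := congrArg Prod.fst h; simp at this; omega)]
    simp [T1diff, mono]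
    ring
  · intro p hp
    obtain ⟨p, q⟩ := p
    simp only [Function.mem_support] at hp
    by_contra hc
    apply hp
    simp only [Finset.coe_insert, Finset.coe_singleton, Set.mem_insert_iff,
      Set.mem_singleton_iff, Prod.mk.injEq, not_or, not_and] at hc
    have h1 : ¬ (i - p = 1 ∧ j - q = 0) := by rintro ⟨h, h'⟩; exact hc.1 (by omega) (by omega)
    have h2 : ¬ (i - p = -1 ∧ j - q = 0) := by rintro ⟨h, h'⟩; exact hc.2 (by omega) (by omega)
    simp [T1diff, mono, h1, h2]

theorem quotD_step {K : Type*} [CommRing K] (D : PDO K) {N : ℤ}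
    (hN : ∀ i : ℤ, N < i → D i 0 = 0) (i n m : ℤ) :
    quotD D i n m = D (i + 1) 0 n m + quotD D (i + 2) n m := by
  have fin : ∀ k : ℤ, (Function.support fun l : ℕ => D (k + 1 + 2 * (l : ℤ)) 0 n m).Finite := by
    intro k
    apply (Set.finite_Iic ((N - k).toNat)).subset
    intro l hl
    by_contra hc
    apply hl
    have : N < k + 1 + 2 * (l : ℤ) := by
      simp only [Set.mem_Iic, not_le] at hc
      omega
    simp [hN _ this]
  have key : ∀ (f : ℕ → K), (Function.support f).Finite →
      (Function.support fun l => f (l + 1)).Finite → ∑ᶠ l, f l = f 0 + ∑ᶠ l, f (l + 1) := by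
    intro f hf hg
    obtain ⟨B, hB⟩ := hf.bddAbove
    have h1 : ∑ᶠ l, f l = ∑ l ∈ Finset.range (B + 2), f l := by
      apply finsum_eq_sum_of_support_subset
      intro l hl
      have := hB hl
      simp only [Finset.coe_range, Set.mem_Iio]
      omega
    have h2 : ∑ᶠ l, f (l + 1) = ∑ l ∈ Finset.range (B + 1), f (l + 1) := by
      apply finsum_eq_sum_of_support_subset
      intro l hl
      have : l + 1 ≤ B := hB hl
      simp only [Finset.coe_range, Set.mem_Iio]
      omega
    rw [h1, h2, Finset.sum_range_succ', add_comm]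
  have e : (fun l : ℕ => D (i + 2 + 1 + 2 * (l : ℤ)) 0 n m) =
      fun l : ℕ => D (i + 1 + 2 * ((l + 1 : ℕ) : ℤ)) 0 n m := by
    funext l
    have : i + 2 + 1 + 2 * (l : ℤ) = i + 1 + 2 * ((l + 1 : ℕ) : ℤ) := by push_cast; ring
    rw [this]
  unfold quotD
  rw [key _ (fin i) (by have := fin (i + 2); rw [e] at this; exact this), e]
  simp

/-- The representation exists. -/
theorem quotD_mul {K : Type*} [CommRing K] (D : PDO K) {N : ℤ}
    (hN : ∀ i : ℤ, N < i → D i 0 = 0) (hD : ∀ i j : ℤ, j ≠ 0 → D i j = 0) :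
    mul (ofCoeffs (quotD D)) (T1diff K) = D := by
  funext i j n m
  rw [mul_T1diff]
  by_cases hj : j = 0
  · subst hj
    have h := quotD_step D hN (i - 1) n m
    rw [show i - 1 + 1 = i by ring, show i - 1 + 2 = i + 1 by ring] at h
    simp [ofCoeffs, h]
  · simp [ofCoeffs, hj, hD i j hj]

/-- The representation is unique. -/
theorem quotD_unique {K : Type*} [CommRing K] (D : PDO K) (f : ℤ → LatFun K) {N : ℤ}
    (hN : ∀ i : ℤ, N < i → f i = 0) (h : mul (ofCoeffs f) (T1diff K) = D) : f = quotD D := by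
  have hstep : ∀ i n m, f i n m = D (i + 1) 0 n m + f (i + 2) n m := by
    intro i n m
    rw [← h, mul_T1diff]
    simp [ofCoeffs, show i + 1 + 1 = i + 2 by ring]
  have hDN : ∀ i : ℤ, N + 1 < i → D i 0 = 0 := by
    intro i hi
    funext n m
    rw [← h, mul_T1diff]
    simp [ofCoeffs, hN (i - 1) (by omega), hN (i + 1) (by omega)]
  have hzero : ∀ i : ℤ, N < i → quotD D i = 0 := by
    intro i hi
    funext n m
    have : ∀ l : ℕ, D (i + 1 + 2 * (l : ℤ)) 0 n m = 0 := by
      intro l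
      rw [hDN _ (by omega)]
      rfl
    simp [quotD, this]
  have main : ∀ k : ℕ, ∀ i : ℤ, N - k < i → f i = quotD D i := by
    intro k
    induction k with
    | zero => intro i hi; rw [hN i (by simpa using hi), hzero i (by simpa using hi)]
    | succ k ih =>
      intro i hi
      funext n m
      rw [hstep, quotD_step D hDN, ih (i + 2) (by push_cast at hi; omega)]
  funext i
  exact main (N - i + 1).toNat i (by omega)

end PDO

open PDO

/-- `H = T₁T₂ - u (T₁ - T₂) - 1`. -/
def Hop {K : Type*} [CommRing K] (u : LatFun K) : PDO K :=
  mono 1 1 1 - mul (mono u 0 0) (mono 1 1 0 - mono 1 0 1) - mono 1 0 0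

/-- `𝓛 = ∑_{s ≥ 0} v_s T₁^{1-s}`. -/
def Lop {K : Type*} [CommRing K] (v : ℕ → LatFun K) : PDO K :=
  ofCoeffs fun i => if i ≤ 1 then v (1 - i).toNat else 0

/-- `D ∈ 𝒪_H⁺ = 𝒪₁⁺ H`. -/
def MemIdealPlus {K : Type*} [CommRing K] (H D : PDO K) : Prop :=
  ∃ E : PDO K, IsPlus E ∧ D = mul E H

/-- `D ∈ 𝒪_H = 𝒪 H`. -/
def MemIdeal {K : Type*} [CommRing K] (H D : PDO K) : Prop :=
  ∃ E : PDO K, IsDiff E ∧ D = mul E H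

/-- The `τ`-ansatz: for some constant `C ≠ 0` and some function `τ` with invertible values,
`u = C (t₁τ)(t₂τ) / ((t₁t₂τ) τ)` and `v₀ = (t₁τ)(t₁⁻¹τ) / τ²`. -/
def Ansatz {K : Type*} [CommRing K] [Algebra ℂ K] (u v₀ : LatFun K) : Prop :=
  ∃ (C : ℂ) (τ : ℤ → ℤ → Kˣ), C ≠ 0 ∧ ∀ n m : ℤ,
    u n m = algebraMap ℂ K C *
      ((τ (n + 1) m * τ n (m + 1) / (τ (n + 1) (m + 1) * τ n m) : Kˣ) : K) ∧
    v₀ n m = ((τ (n + 1) m * τ (n - 1) m / τ n m ^ 2 : Kˣ) : K)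

/-- The space `𝒮` of pairs `(H, 𝓛)`, with coefficients that take values in the commutative
`ℂ`-algebra `K`. -/
def NVSpace (K : Type*) [CommRing K] [Algebra ℂ K] : Set (PDO K × PDO K) :=
  {x | ∃ (u : LatFun K) (v : ℕ → LatFun K), x.1 = Hop u ∧ x.2 = Lop v ∧
    MemIdealPlus x.1 (bracket x.1 x.2) ∧ Ansatz u (v 0)}

/-- `L_j = (f₀ + ∑_{i=1}^{j-1} (f_i T₁^i + T₁^{-i} f_i)) (T₁ - T₁⁻¹)`, where
`𝓛^j = ∑_{i ≤ j-1} f_i T₁^i (T₁ - T₁⁻¹)`. -/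
def laxOp {K : Type*} [CommRing K] (j : ℕ) (L : PDO K) : PDO K :=
  mul (mono (quotD (pow L j) 0) 0 0 + ∑ i ∈ Finset.Ico 1 j,
      (mono (quotD (pow L j) i) i 0 + mul (mono 1 (-(i : ℤ)) 0) (mono (quotD (pow L j) i) 0 0)))
    (T1diff K)

/-- The pair `ξ = (∂H, ∂𝓛)` satisfies the `j`-th equations at `x = (H, 𝓛)`:
`∂𝓛 = [L_j, 𝓛]` and `∂H ≡ [L_j, H] mod 𝒪_H`. -/
def SatisfiesEq {K : Type*} [CommRing K] (j : ℕ) (x ξ : PDO K × PDO K) : Prop :=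
  ξ.2 = bracket (laxOp j x.2) x.2 ∧ MemIdeal x.1 (ξ.1 - bracket (laxOp j x.2) x.1)

/-- The point `x + ε ξ`, with coefficients in the dual numbers. -/
def pointEps {K : Type*} [CommRing K] (x ξ : PDO K × PDO K) :
    PDO (DualNumber K) × PDO (DualNumber K) :=
  (addEps x.1 ξ.1, addEps x.2 ξ.2)

/-- `ξ` is tangent to `𝒮` at `x`: the constraints that define `𝒮` hold for `x + ε ξ`, `ε² = 0`. -/
def IsTangent {K : Type*} [CommRing K] [Algebra ℂ K] (x ξ : PDO K × PDO K) : Prop :=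
  pointEps x ξ ∈ NVSpace (DualNumber K)

/-- `ξ` is the value at `x` of the `j`-th vector field: a tangent vector to `𝒮` at `x` that
satisfies the `j`-th equations. -/
def IsField {K : Type*} [CommRing K] [Algebra ℂ K] (j : ℕ) (x ξ : PDO K × PDO K) : Prop :=
  IsTangent x ξ ∧ SatisfiesEq j x ξ

/-- `X = (H(t), 𝓛(t))` is a formal trajectory of the `j`-th flow that starts at `x`: it lies in `𝒮`,
with coefficients in `K⟦t⟧`, it equals `x` for `t = 0`, and `∂_t X` satisfies the `j`-th
equations. -/
def IsTrajectory {K : Type*} [CommRing K] [Algebra ℂ K] (j : ℕ) (x : PDO K × PDO K)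
    (X : PDO (PowerSeries K) × PDO (PowerSeries K)) : Prop :=
  X ∈ NVSpace (PowerSeries K) ∧
  PDO.map (PowerSeries.constantCoeff (R := K)) X.1 = x.1 ∧
  PDO.map (PowerSeries.constantCoeff (R := K)) X.2 = x.2 ∧
  SatisfiesEq j X (PDO.map (PowerSeries.derivative K) X.1, PDO.map (PowerSeries.derivative K) X.2)

/-- The coefficient of `s^a t^b` in an operator with coefficients in `K⟦s⟧⟦t⟧`. -/
def coeff₂ {K : Type*} [CommRing K] (a b : ℕ) (D : PDO (PowerSeries (PowerSeries K))) : PDO K :=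
  PDO.map (fun f => PowerSeries.coeff a (PowerSeries.coeff b f)) D

end

end DiscreteNV

namespace DiscreteNV

noncomputable section

open PDO

/-! ### The ring `𝒪₁⁺` -/

namespace PDO

variable {K : Type*} [CommRing K]

/-! Write S = T₁ - T₁⁻¹, which is skew-adjoint, and L_j = D_j S. Here D_j is selfadjoint without T₂,
and N_j = 𝓛^j - L_j has order at most 0 in T₁ (`ordLE_pow_sub_lax`). These properties characterize
D_j: a selfadjoint D without T₂ for which D S has order at most 0 is zero, since adjunction
exchanges T₁^i and T₁^{-i} (`eq_zero_of_isAdj`). Most of the proof rests on this rigidity.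

Evolution of H. Modulo left multiples of H, both S and S T₂ are multiples of T₁ - T₂, with factors
adjoint to the coefficients of H. Hence H D_j S = G (T₁ - T₂) + E H with G selfadjoint (`opH_mul`).
The relation H 𝓛 = e H gives (e^j - E) H = H N_j + G (T₁ - T₂). Comparing coefficients shows that G
has order at most 0, so G is a function: u times the difference g_j(n+1, m) - g_j(n+1, m+1), where
g_j is the coefficient of T₁⁰ in N_j (`residue_eq`). This forces ∂u. The leading coefficient of
[L_j, 𝓛] = [𝓛, N_j] gives ∂v₀ = v₀ (g_j(n+1, m) - g_j(n, m)). Both laws come from a logarithmic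
derivative φ of τ with φ(n) - φ(n-1) = g_j(n), so the ansatz persists. The relation H 𝓛 = e H
persists with ∂e = [E, e] (`opMap_semiconj`).

Commutation. The defect of ∂_i L_j - ∂_j L_i = [L_i, L_j] is again D S with D selfadjoint, and it
has order at most 0 when rewritten through the N's, so it vanishes (`zero_curvature`). Then [L_i, ·]
and [L_j, ·] give commuting fields on 𝓛, and the order-0 part of the same identity gives ∂_i g_j =
∂_j g_i, hence commutation on u (`logDer_comm`).

Formal flows. All constructions commute with changes of coefficient ring, so the equations make
sense modulo t^k and Picard iteration applies (`exists_formal_solution`). Preservation of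
constraints and commutation of the flows follow by induction on k: a defect that vanishes modulo t^k
has a derivative that vanishes modulo t^k. Derivations along a ring homomorphism (`IsDer`) let the
same algebra serve for K[ε] → K and for K⟦t⟧ → K⟦t⟧/(t^k). -/

theorem mul_eq_sum {a b : PDO K} {i j n m : ℤ} (k l : ℤ) (s : Finset (ℤ × ℤ))
    (h : ∀ p : ℤ × ℤ, a (p.1 - k) (p.2 - l) n m *
      b (i - (p.1 - k)) (j - (p.2 - l)) (n + (p.1 - k)) (m + (p.2 - l)) ≠ 0 → p ∈ s) :
    mul a b i j n m = ∑ p ∈ s, a (p.1 - k) (p.2 - l) n m *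
      b (i - (p.1 - k)) (j - (p.2 - l)) (n + (p.1 - k)) (m + (p.2 - l)) := by
  unfold mul
  -- The offset (k, l) translates the summation index; with it the inner sums in the associativity
  -- proof can run over one fixed box.
  rw [← finsum_comp_equiv (Equiv.subRight ((k, l) : ℤ × ℤ))]
  exact finsum_eq_sum_of_support_subset _ (fun p hp => h p hp)

/-- `D` lies in the part of the filtration of `𝒪₁⁺` that is given by the bounds `N` for the
exponents of `T₁` and `M` for the exponents of `T₂`. -/
def Bdd (N M : ℤ) (D : PDO K) : Prop :=
  (∀ i j, N < i → D i j = 0) ∧ ∀ i j, M < |j| → D i j = 0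

theorem isPlus_iff {D : PDO K} : IsPlus D ↔ ∃ N M, Bdd N M D :=
  ⟨fun ⟨⟨N, hN⟩, M, hM⟩ => ⟨N, M, hN, hM⟩, fun ⟨N, M, hN, hM⟩ => ⟨⟨N, hN⟩, M, hM⟩⟩

theorem Bdd.mem {N M : ℤ} {D : PDO K} (h : Bdd N M D) {i j n m : ℤ} (hD : D i j n m ≠ 0) :
    i ≤ N ∧ -M ≤ j ∧ j ≤ M := by
  have h1 : i ≤ N := by
    by_contra hc
    exact hD (by rw [h.1 i j (by omega)]; rfl)
  have h2 : |j| ≤ M := by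
    by_contra hc
    exact hD (by rw [h.2 i j (by omega)]; rfl)
  exact ⟨h1, abs_le.1 h2⟩

/-- The box in which the terms of the coefficient `i` of a product lie. -/
def box (N N' M i : ℤ) : Finset (ℤ × ℤ) := Finset.Icc (i - N') N ×ˢ Finset.Icc (-M) M

theorem mul_eq_box {a b : PDO K} {N M N' M' : ℤ} (ha : Bdd N M a) (hb : Bdd N' M' b)
    (i j n m : ℤ) : mul a b i j n m = ∑ p ∈ box N N' M i,
      a p.1 p.2 n m * b (i - p.1) (j - p.2) (n + p.1) (m + p.2) := by
  have := mul_eq_sum (a := a) (b := b) (i := i) (j := j) (n := n) (m := m) 0 0 (box N N' M i) (by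
    intro p hp
    simp only [sub_zero] at hp
    have h1 := ha.mem (left_ne_zero_of_mul hp)
    have h2 := hb.mem (right_ne_zero_of_mul hp)
    simp only [box, Finset.mem_product, Finset.mem_Icc]
    omega)
  simpa using this

theorem Bdd.mul {a b : PDO K} {N M N' M' : ℤ} (ha : Bdd N M a) (hb : Bdd N' M' b) :
    Bdd (N + N') (M + M') (PDO.mul a b) := by
  have key : ∀ i j n m, PDO.mul a b i j n m ≠ 0 → i ≤ N + N' ∧ |j| ≤ M + M' := by
    intro i j n m h
    rw [mul_eq_box ha hb] at h
    obtain ⟨p, -, hp⟩ := Finset.exists_ne_zero_of_sum_ne_zero h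
    have h1 := ha.mem (left_ne_zero_of_mul hp)
    have h2 := hb.mem (right_ne_zero_of_mul hp)
    rw [abs_le]
    omega
  constructor
  · intro i j hi
    funext n m
    by_contra hc
    have := (key i j n m hc).1
    omega
  · intro i j hi
    funext n m
    by_contra hc
    have := (key i j n m hc).2
    omega

theorem Bdd.mono {a : PDO K} {N M N' M' : ℤ} (ha : Bdd N M a) (hN : N ≤ N') (hM : M ≤ M') :
    Bdd N' M' a :=
  ⟨fun i j h => ha.1 i j (by omega), fun i j h => ha.2 i j (by omega)⟩

theorem Bdd.add {a b : PDO K} {N M : ℤ} (ha : Bdd N M a) (hb : Bdd N M b) :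
    Bdd N M (a + b) :=
  ⟨fun i j h => by simp [ha.1 i j h, hb.1 i j h], fun i j h => by simp [ha.2 i j h, hb.2 i j h]⟩

theorem Bdd.neg {a : PDO K} {N M : ℤ} (ha : Bdd N M a) : Bdd N M (-a) :=
  ⟨fun i j h => by simp [ha.1 i j h], fun i j h => by simp [ha.2 i j h]⟩

theorem bdd_common {a b : PDO K} (ha : IsPlus a) (hb : IsPlus b) :
    ∃ N M, Bdd N M a ∧ Bdd N M b := by
  obtain ⟨N, M, h⟩ := isPlus_iff.1 ha
  obtain ⟨N', M', h'⟩ := isPlus_iff.1 hb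
  exact ⟨max N N', max M M', h.mono (le_max_left _ _) (le_max_left _ _),
    h'.mono (le_max_right _ _) (le_max_right _ _)⟩

/-- The bounds put every nonzero term of the double sum in one product of two finite boxes, where
the order of summation can be exchanged. -/
theorem mul_assoc_of_bdd {a b c : PDO K} {N M : ℤ} (ha : Bdd N M a) (hb : Bdd N M b)
    (hc : Bdd N M c) : mul (mul a b) c = mul a (mul b c) := by
  funext i j n m
  rw [mul_eq_box (ha.mul hb) hc, mul_eq_box ha (hb.mul hc)]
  have e1 : ∀ p ∈ box (N + N) N (M + M) i, mul a b p.1 p.2 n m *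
      c (i - p.1) (j - p.2) (n + p.1) (m + p.2) = ∑ q ∈ box N (N + N) M i,
      a q.1 q.2 n m * b (p.1 - q.1) (p.2 - q.2) (n + q.1) (m + q.2) *
      c (i - p.1) (j - p.2) (n + p.1) (m + p.2) := by
    intro p hp
    simp only [box, Finset.mem_product, Finset.mem_Icc] at hp
    have := mul_eq_sum (a := a) (b := b) (i := p.1) (j := p.2) (n := n) (m := m) 0 0
      (box N (N + N) M i) (by
        intro q hq
        simp only [sub_zero] at hq
        have h1 := ha.mem (left_ne_zero_of_mul hq)
        have h2 := hb.mem (right_ne_zero_of_mul hq)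
        simp only [box, Finset.mem_product, Finset.mem_Icc]
        omega)
    rw [this, Finset.sum_mul]
    simp
  have e2 : ∀ q ∈ box N (N + N) M i, a q.1 q.2 n m *
      mul b c (i - q.1) (j - q.2) (n + q.1) (m + q.2) = ∑ p ∈ box (N + N) N (M + M) i,
      a q.1 q.2 n m * b (p.1 - q.1) (p.2 - q.2) (n + q.1) (m + q.2) *
      c (i - p.1) (j - p.2) (n + p.1) (m + p.2) := by
    intro q hq
    simp only [box, Finset.mem_product, Finset.mem_Icc] at hq
    have := mul_eq_sum (a := b) (b := c) (i := i - q.1) (j := j - q.2) (n := n + q.1)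
      (m := m + q.2) q.1 q.2 (box (N + N) N (M + M) i) (by
        intro p hp
        have h1 := hb.mem (left_ne_zero_of_mul hp)
        have h2 := hc.mem (right_ne_zero_of_mul hp)
        simp only [box, Finset.mem_product, Finset.mem_Icc]
        omega)
    rw [this, Finset.mul_sum]
    refine Finset.sum_congr rfl fun p _ => ?_
    rw [show i - q.1 - (p.1 - q.1) = i - p.1 by ring, show j - q.2 - (p.2 - q.2) = j - p.2 by ring,
      show n + q.1 + (p.1 - q.1) = n + p.1 by ring, show m + q.2 + (p.2 - q.2) = m + p.2 by ring]
    ring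
  rw [Finset.sum_congr rfl e1, Finset.sum_congr rfl e2, Finset.sum_comm]

theorem mono_mul_apply (r : LatFun K) (k l : ℤ) (b : PDO K) (i j n m : ℤ) :
    mul (mono r k l) b i j n m = r n m * b (i - k) (j - l) (n + k) (m + l) := by
  have := mul_eq_sum (a := mono r k l) (b := b) (i := i) (j := j) (n := n) (m := m) 0 0 {(k, l)} (by
    rintro ⟨p, q⟩ hp
    by_contra hc
    apply hp
    have : ¬ (p = k ∧ q = l) := by simpa using hc
    simp [PDO.mono, this])
  simpa [PDO.mono] using this

theorem mul_mono_apply (a : PDO K) (r : LatFun K) (k l i j n m : ℤ) :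
    mul a (mono r k l) i j n m = a (i - k) (j - l) n m * r (n + i - k) (m + j - l) := by
  have := mul_eq_sum (a := a) (b := mono r k l) (i := i) (j := j) (n := n) (m := m) 0 0
    {(i - k, j - l)} (by
    rintro ⟨p, q⟩ hp
    by_contra hc
    apply hp
    have : ¬ (i - p = k ∧ j - q = l) := by
      rintro ⟨h, h'⟩
      exact hc (by simp; omega)
    simp [PDO.mono, this])
  simpa [PDO.mono, add_sub_assoc] using this

theorem bdd_mono (r : LatFun K) (k l : ℤ) : Bdd k |l| (mono r k l) := by
  constructor
  · intro i j h
    have : ¬ (i = k ∧ j = l) := by omega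
    simp [PDO.mono, this]
  · intro i j h
    have : ¬ (i = k ∧ j = l) := by
      rintro ⟨-, rfl⟩
      omega
    simp [PDO.mono, this]

theorem mul_add_of_bdd {a b c : PDO K} {N M : ℤ} (ha : Bdd N M a) (hb : Bdd N M b)
    (hc : Bdd N M c) : mul a (b + c) = mul a b + mul a c := by
  funext i j n m
  simp only [Pi.add_apply]
  rw [mul_eq_box ha hb, mul_eq_box ha hc, mul_eq_box ha (hb.add hc), ← Finset.sum_add_distrib]
  exact Finset.sum_congr rfl fun p _ => by simp [mul_add]

theorem add_mul_of_bdd {a b c : PDO K} {N M : ℤ} (ha : Bdd N M a) (hb : Bdd N M b)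
    (hc : Bdd N M c) : mul (a + b) c = mul a c + mul b c := by
  funext i j n m
  simp only [Pi.add_apply]
  rw [mul_eq_box ha hc, mul_eq_box hb hc, mul_eq_box (ha.add hb) hc, ← Finset.sum_add_distrib]
  exact Finset.sum_congr rfl fun p _ => by simp [add_mul]

/-- The additive group of `𝒪₁⁺`. -/
def plusGroup (K : Type*) [CommRing K] : AddSubgroup (PDO K) where
  carrier := {D | IsPlus D}
  zero_mem' := isPlus_iff.2 ⟨0, 0, fun _ _ _ => rfl, fun _ _ _ => rfl⟩
  add_mem' ha hb := by
    obtain ⟨N, M, h, h'⟩ := bdd_common ha hb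
    exact isPlus_iff.2 ⟨N, M, h.add h'⟩
  neg_mem' ha := by
    obtain ⟨N, M, h⟩ := isPlus_iff.1 ha
    exact isPlus_iff.2 ⟨N, M, h.neg⟩

end PDO

/-- The ring `𝒪₁⁺`. -/
def Op (K : Type*) [CommRing K] : Type _ := plusGroup K

namespace Op

variable {K : Type*} [CommRing K]

instance : AddCommGroup (Op K) := inferInstanceAs (AddCommGroup (plusGroup K))

/-- The formal expression for an element of `𝒪₁⁺`. -/
def val (x : Op K) : PDO K := x.1

theorem isPlus (x : Op K) : IsPlus x.val := x.2

/-- An element of `𝒪₁⁺`, given by a formal expression. -/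
def mk (D : PDO K) (h : IsPlus D) : Op K := ⟨D, h⟩

@[simp] theorem val_mk (D : PDO K) (h : IsPlus D) : (mk D h).val = D := rfl

@[ext] theorem ext {x y : Op K} (h : x.val = y.val) : x = y := Subtype.ext h

theorem exists_bdd (x : Op K) : ∃ N M, Bdd N M x.val := isPlus_iff.1 x.2

instance : Mul (Op K) := ⟨fun x y => ⟨PDO.mul x.1 y.1, by
  obtain ⟨N, M, h, h'⟩ := bdd_common x.2 y.2
  exact isPlus_iff.2 ⟨_, _, h.mul h'⟩⟩⟩

/-- The operator `r T₁^k T₂^l`. -/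
def mono (r : LatFun K) (k l : ℤ) : Op K := ⟨PDO.mono r k l, isPlus_iff.2 ⟨_, _, bdd_mono r k l⟩⟩

instance : One (Op K) := ⟨mono 1 0 0⟩

@[simp] theorem val_zero : (0 : Op K).val = 0 := rfl
@[simp] theorem val_one : (1 : Op K).val = PDO.mono 1 0 0 := rfl
@[simp] theorem val_add (x y : Op K) : (x + y).val = x.val + y.val := rfl
@[simp] theorem val_sub (x y : Op K) : (x - y).val = x.val - y.val := rfl
@[simp] theorem val_neg (x : Op K) : (-x).val = -x.val := rfl
@[simp] theorem val_mul (x y : Op K) : (x * y).val = PDO.mul x.val y.val := rfl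
@[simp] theorem val_mono (r : LatFun K) (k l : ℤ) : (mono r k l).val = PDO.mono r k l := rfl

theorem common (x y z : Op K) : ∃ N M, Bdd N M x.val ∧ Bdd N M y.val ∧ Bdd N M z.val := by
  obtain ⟨N, M, h1, h2⟩ := bdd_common x.2 y.2
  obtain ⟨N', M', h3⟩ := z.exists_bdd
  exact ⟨max N N', max M M', h1.mono (le_max_left _ _) (le_max_left _ _),
    h2.mono (le_max_left _ _) (le_max_left _ _), h3.mono (le_max_right _ _) (le_max_right _ _)⟩

instance : Ring (Op K) where
  __ := (inferInstance : AddCommGroup (Op K))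
  mul_assoc x y z := by
    obtain ⟨N, M, hx, hy, hz⟩ := common x y z
    exact ext (mul_assoc_of_bdd hx hy hz)
  left_distrib x y z := by
    obtain ⟨N, M, hx, hy, hz⟩ := common x y z
    exact ext (mul_add_of_bdd hx hy hz)
  right_distrib x y z := by
    obtain ⟨N, M, hx, hy, hz⟩ := common x y z
    exact ext (add_mul_of_bdd hx hy hz)
  zero_mul x := by
    ext i j n m
    simp [PDO.mul]
  mul_zero x := by
    ext i j n m
    simp [PDO.mul]
  one_mul x := by
    ext i j n m
    simp [mono_mul_apply]
  mul_one x := by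
    ext i j n m
    simp [mul_mono_apply]

theorem val_pow (x : Op K) (j : ℕ) : (x ^ j).val = PDO.pow x.val j := by
  induction j with
  | zero => simp [PDO.pow]
  | succ j ih => rw [pow_succ, val_mul, ih]; rfl

theorem val_bracket (x y : Op K) : (x * y - y * x).val = bracket x.val y.val := rfl

theorem val_sum {ι : Type*} (s : Finset ι) (f : ι → Op K) :
    (∑ i ∈ s, f i).val = ∑ i ∈ s, (f i).val := by
  classical
  induction s using Finset.induction_on with
  | empty => rfl
  | insert a s ha ih => rw [Finset.sum_insert ha, Finset.sum_insert ha, val_add, ih]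

theorem mono_mul_mono (r r' : LatFun K) (k l k' l' : ℤ) : mono r k l * mono r' k' l' =
    mono (fun n m => r n m * r' (n + k) (m + l)) (k + k') (l + l') := by
  ext i j n m
  simp only [val_mul, val_mono, mono_mul_apply, PDO.mono]
  by_cases h : i = k + k' ∧ j = l + l'
  · have h' : i - k = k' ∧ j - l = l' := by omega
    simp [h]
  · have h' : ¬ (i - k = k' ∧ j - l = l') := by omega
    simp [h, h']

theorem mono_add (r r' : LatFun K) (k l : ℤ) : mono (r + r') k l = mono r k l + mono r' k l := by
  ext i j n m
  by_cases h : i = k ∧ j = l <;> simp [PDO.mono, h]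

/-- `T₁`. -/
def T₁ : Op K := mono 1 1 0
/-- `T₁⁻¹`. -/
def T₁i : Op K := mono 1 (-1) 0
/-- `T₂`. -/
def T₂ : Op K := mono 1 0 1
/-- `T₂⁻¹`. -/
def T₂i : Op K := mono 1 0 (-1)
/-- Multiplication by a function. -/
def fn (r : LatFun K) : Op K := mono r 0 0

theorem one_def : (1 : Op K) = mono 1 0 0 := rfl

theorem T₁i_mul_T₁ : (T₁i * T₁ : Op K) = 1 := by
  simp [T₁i, T₁, mono_mul_mono, one_def]; rfl
theorem T₂i_mul_T₂ : (T₂i * T₂ : Op K) = 1 := by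
  simp [T₂i, T₂, mono_mul_mono, one_def]; rfl
theorem T₂_mul_T₁ : (T₂ * T₁ : Op K) = T₁ * T₂ := by
  simp [T₁, T₂, mono_mul_mono]
theorem T₂_mul_T₁i : (T₂ * T₁i : Op K) = T₁i * T₂ := by
  simp [T₁i, T₂, mono_mul_mono]

end Op

end

end DiscreteNV

namespace DiscreteNV

noncomputable section

open PDO

namespace PDO

variable {K : Type*} [CommRing K]

theorem exists_of_mul_ne_zero {a b : PDO K} {i j n m : ℤ} (h : mul a b i j n m ≠ 0) :
    ∃ p q, a p q n m ≠ 0 ∧ b (i - p) (j - q) (n + p) (m + q) ≠ 0 := by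
  obtain ⟨p, hp⟩ : ∃ p : ℤ × ℤ, a p.1 p.2 n m * b (i - p.1) (j - p.2) (n + p.1) (m + p.2) ≠ 0 := by
    by_contra hc
    push Not at hc
    exact h (finsum_eq_zero_of_forall_eq_zero hc)
  exact ⟨p.1, p.2, left_ne_zero_of_mul hp, right_ne_zero_of_mul hp⟩

/-- The formal adjoint, `(r T₁^k T₂^l)^* = T₁^{-k} T₂^{-l} r`. -/
def adj (D : PDO K) : PDO K := fun i j n m => D (-i) (-j) (n + i) (m + j)

/-- Adjunction turns 𝒪₁⁺ into 𝒪₁⁻, hence the setting of arbitrary formal expressions. A translation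
of the index matches the two sums term by term, so no finiteness is needed. -/
theorem adj_mul (a b : PDO K) : adj (mul a b) = mul (adj b) (adj a) := by
  funext i j n m
  simp only [adj, mul]
  rw [← finsum_comp_equiv (Equiv.subRight ((i, j) : ℤ × ℤ))]
  refine finsum_congr fun p => ?_
  simp only [Equiv.subRight_apply, Prod.fst_sub, Prod.snd_sub]
  rw [show -i - (p.1 - i) = -p.1 by ring, show -j - (p.2 - j) = -p.2 by ring,
    show n + i + (p.1 - i) = n + p.1 by ring, show m + j + (p.2 - j) = m + p.2 by ring,
    show -(i - p.1) = p.1 - i by ring, show -(j - p.2) = p.2 - j by ring,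
    show n + p.1 + (i - p.1) = n + i by ring, show m + p.2 + (j - p.2) = m + j by ring, mul_comm]

theorem adj_mono (r : LatFun K) (k l : ℤ) :
    adj (mono r k l) = mono (fun n m => r (n - k) (m - l)) (-k) (-l) := by
  funext i j n m
  simp only [adj, mono]
  by_cases h : i = -k ∧ j = -l
  · have h' : -i = k ∧ -j = l := by omega
    simp [h, sub_eq_add_neg]
  · have h' : ¬ (-i = k ∧ -j = l) := by omega
    simp [h, h']

theorem adj_mono_one (k l : ℤ) : adj (mono (1 : LatFun K) k l) = mono 1 (-k) (-l) :=
  adj_mono _ _ _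

end PDO

namespace Op

variable {K : Type*} [CommRing K]

theorem exists_of_mul_ne {x y : Op K} {i j n m : ℤ} (h : (x * y).val i j n m ≠ 0) :
    ∃ p q, x.val p q n m ≠ 0 ∧ y.val (i - p) (j - q) (n + p) (m + q) ≠ 0 :=
  exists_of_mul_ne_zero h

/-! ### Adjoint operators -/

/-- The operators `x` and `y` are formally adjoint. -/
def IsAdj (x y : Op K) : Prop := adj x.val = y.val

theorem IsAdj.add {x y x' y' : Op K} (h : IsAdj x y) (h' : IsAdj x' y') :
    IsAdj (x + x') (y + y') := by
  unfold IsAdj at *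
  rw [val_add, val_add, ← h, ← h']
  rfl

theorem IsAdj.sub {x y x' y' : Op K} (h : IsAdj x y) (h' : IsAdj x' y') :
    IsAdj (x - x') (y - y') := by
  unfold IsAdj at *
  rw [val_sub, val_sub, ← h, ← h']
  rfl

theorem IsAdj.mul {x y x' y' : Op K} (h : IsAdj x y) (h' : IsAdj x' y') :
    IsAdj (x * x') (y' * y) := by
  unfold IsAdj at *
  rw [val_mul, val_mul, ← h, ← h', adj_mul]

theorem IsAdj.sum {ι : Type*} {s : Finset ι} {f g : ι → Op K} (h : ∀ i ∈ s, IsAdj (f i) (g i)) :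
    IsAdj (∑ i ∈ s, f i) (∑ i ∈ s, g i) := by
  classical
  induction s using Finset.induction_on with
  | empty => exact rfl
  | insert a s ha ih =>
    rw [Finset.sum_insert ha, Finset.sum_insert ha]
    exact (h a (by simp)).add (ih fun i hi => h i (by simp [hi]))

theorem isAdj_T₁ : IsAdj (T₁ : Op K) T₁i := adj_mono _ _ _
theorem isAdj_T₁i : IsAdj (T₁i : Op K) T₁ := by
  have := adj_mono_one (K := K) (-1) 0
  simpa [IsAdj, T₁, T₁i] using this
theorem isAdj_T₂ : IsAdj (T₂ : Op K) T₂i := adj_mono _ _ _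
theorem isAdj_T₂i : IsAdj (T₂i : Op K) T₂ := by
  have := adj_mono_one (K := K) 0 (-1)
  simpa [IsAdj, T₂, T₂i] using this
theorem isAdj_fn (r : LatFun K) : IsAdj (fn r) (fn r) := by
  have := adj_mono r 0 0
  simpa [IsAdj, fn] using this
theorem isAdj_one : IsAdj (1 : Op K) 1 := isAdj_fn 1

/-! ### Operators without `T₂`, and difference operators -/

/-- The ring of the operators that do not contain `T₂`. -/
def freeRing (K : Type*) [CommRing K] : Subring (Op K) where
  carrier := {x | ∀ i j, j ≠ 0 → x.val i j = 0}
  zero_mem' _ _ _ := rfl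
  one_mem' i j h := by simp [PDO.mono, h]
  add_mem' ha hb i j h := by simp [ha i j h, hb i j h]
  neg_mem' ha i j h := by simp [ha i j h]
  mul_mem' {a b} ha hb i j h := by
    funext n m
    by_contra hc
    obtain ⟨p, q, h1, h2⟩ := exists_of_mul_ne hc
    have hq : q = 0 := by
      by_contra hq
      exact h1 (by rw [ha p q hq]; rfl)
    exact h2 (by rw [hb _ _ (by omega)]; rfl)

/-- The ring `𝒪`. -/
def diffRing (K : Type*) [CommRing K] : Subring (Op K) where
  carrier := {x | ∃ N : ℤ, ∀ i j, i < N → x.val i j = 0}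
  zero_mem' := ⟨0, fun _ _ _ => rfl⟩
  one_mem' := ⟨0, fun i j h => by simp [PDO.mono, h.ne]⟩
  add_mem' := by
    rintro a b ⟨N, ha⟩ ⟨N', hb⟩
    exact ⟨min N N', fun i j h => by
      simp [ha i j (h.trans_le (min_le_left _ _)), hb i j (h.trans_le (min_le_right _ _))]⟩
  neg_mem' := by
    rintro a ⟨N, ha⟩
    exact ⟨N, fun i j h => by simp [ha i j h]⟩
  mul_mem' := by
    rintro a b ⟨N, ha⟩ ⟨N', hb⟩
    refine ⟨N + N', fun i j h => ?_⟩
    funext n m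
    by_contra hc
    obtain ⟨p, q, h1, h2⟩ := exists_of_mul_ne hc
    have hq : N ≤ p := by
      by_contra hq
      exact h1 (by rw [ha p q (by omega)]; rfl)
    exact h2 (by rw [hb _ _ (by omega)]; rfl)

theorem isDiff_of_mem {x : Op K} (h : x ∈ diffRing K) : IsDiff x.val := by
  obtain ⟨N, M, -, h2⟩ := x.exists_bdd
  exact ⟨x.isPlus, h, M, h2⟩

theorem mono_mem_diffRing (r : LatFun K) (k l : ℤ) : mono r k l ∈ diffRing K :=
  ⟨k, fun i j h => by simp [PDO.mono, h.ne]⟩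

theorem mono_mem_freeRing (r : LatFun K) (k : ℤ) : mono r k 0 ∈ freeRing K :=
  fun i j h => by simp [PDO.mono, h]

theorem free_conj {x : Op K} (h : x ∈ freeRing K) : T₂ * x * T₂i ∈ freeRing K := by
  intro i j hj
  funext n m
  simp [T₂, T₂i, mul_mono_apply, mono_mul_apply, h i j hj]

theorem free_ext {x y : Op K} (hx : x ∈ freeRing K) (hy : y ∈ freeRing K)
    (h : ∀ i, x.val i 0 = y.val i 0) : x = y := by
  ext i j n m
  by_cases hj : j = 0
  · rw [hj, h i]
  · rw [hx i j hj, hy i j hj]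

/-! ### The order in `T₁` -/

/-- `x` has order at most `d` in `T₁`. -/
def OrdLE (d : ℤ) (x : Op K) : Prop := ∀ i j, d < i → x.val i j = 0

theorem OrdLE.add {d : ℤ} {x y : Op K} (hx : OrdLE d x) (hy : OrdLE d y) : OrdLE d (x + y) :=
  fun i j h => by simp [hx i j h, hy i j h]

theorem OrdLE.sub {d : ℤ} {x y : Op K} (hx : OrdLE d x) (hy : OrdLE d y) : OrdLE d (x - y) :=
  fun i j h => by simp [hx i j h, hy i j h]

theorem OrdLE.mul {d e : ℤ} {x y : Op K} (hx : OrdLE d x) (hy : OrdLE e y) :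
    OrdLE (d + e) (x * y) := by
  intro i j h
  funext n m
  by_contra hc
  obtain ⟨p, q, h1, h2⟩ := exists_of_mul_ne hc
  have hq : p ≤ d := by
    by_contra hq
    exact h1 (by rw [hx p q (by omega)]; rfl)
  exact h2 (by rw [hy _ _ (by omega)]; rfl)

theorem ordLE_one : OrdLE 0 (1 : Op K) := fun i j h => by simp [PDO.mono, h.ne']

theorem OrdLE.pow {x : Op K} (hx : OrdLE 1 x) (j : ℕ) : OrdLE j (x ^ j) := by
  induction j with
  | zero => simpa using ordLE_one
  | succ j ih =>
    rw [pow_succ]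
    exact_mod_cast ih.mul hx

/-- The two orders leave only the product of the top terms, and T₁^d shifts the coefficient of y by
d. -/
theorem top_coeff {d e : ℤ} {x y : Op K} (hx : OrdLE d x) (hy : OrdLE e y)
    (hf : x ∈ freeRing K) (n m : ℤ) :
    (x * y).val (d + e) 0 n m = x.val d 0 n m * y.val e 0 (n + d) m := by
  have := mul_eq_sum (a := x.val) (b := y.val) (i := d + e) (j := 0) (n := n) (m := m) 0 0
    {(d, 0)} (by
    rintro ⟨p, q⟩ hp
    simp only [sub_zero] at hp
    have h1 := left_ne_zero_of_mul hp
    have h2 := right_ne_zero_of_mul hp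
    have hq : q = 0 := by
      by_contra hq
      exact h1 (by rw [hf p q hq]; rfl)
    have hp : p ≤ d := by
      by_contra hq
      exact h1 (by rw [hx p q (by omega)]; rfl)
    have hp' : d ≤ p := by
      by_contra hq
      exact h2 (by rw [hy _ _ (by omega)]; rfl)
    simp [le_antisymm hp hp', hq])
  simpa using this

/-- The operator `T₁ - T₁⁻¹`. -/
def S : Op K := T₁ - T₁i

theorem val_S : (S : Op K).val = T1diff K := rfl

theorem mul_S_apply (x : Op K) (i j n m : ℤ) :
    (x * S).val i j n m = x.val (i - 1) j n m - x.val (i + 1) j n m := mul_T1diff _ _ _ _ _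

theorem isAdj_S : IsAdj (S : Op K) (-S) := by
  have := (isAdj_T₁ (K := K)).sub isAdj_T₁i
  rwa [show (T₁i - T₁ : Op K) = -S by simp [S]] at this

/-- The coefficient of T₁^{i+1} in x S is x_i - x_{i+2}, so vanishing descends in steps of two from
the region where x is zero. -/
theorem ordLE_of_mul_S {x : Op K} {d : ℤ} (h : OrdLE (d + 1) (x * S)) : OrdLE d x := by
  obtain ⟨N, M, hb⟩ := x.exists_bdd
  have key : ∀ k : ℕ, ∀ i j, N - k < i → d < i → x.val i j = 0 := by
    intro k
    induction k with
    | zero => exact fun i j h _ => hb.1 i j (by simpa using h)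
    | succ k ih =>
      intro i j hi hd
      funext n m
      have h1 := congrFun (congrFun (h (i + 1) j (by omega)) n) m
      rw [mul_S_apply, show i + 1 - 1 = i by ring, ih (i + 1 + 1) j (by push_cast at hi; omega)
        (by omega)] at h1
      simpa using h1
  exact fun i j h => key (N - i + 1).toNat i j (by omega) h

/-- A selfadjoint `D` for which `D (T₁ - T₁⁻¹)` has order at most `0` vanishes. -/
theorem eq_zero_of_isAdj {x : Op K} (hf : x ∈ freeRing K) (ha : IsAdj x x)
    (h : OrdLE 0 (x * S)) : x = 0 := by
  have ho : OrdLE (-1) x := ordLE_of_mul_S (by simpa using h)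
  refine free_ext hf (Subring.zero_mem _) fun i => ?_
  funext n m
  by_cases hi : -1 < i
  · rw [ho i 0 hi]; rfl
  · rw [← ha, adj, ho (-i) (-0) (by omega)]; rfl

/-- Adjunction exchanges T₁^i and T₁^{-i}, so an upper bound 0 for the exponents is a lower bound
too. -/
theorem eq_fn_of_isAdj {x : Op K} (hf : x ∈ freeRing K) (ha : IsAdj x x)
    (h : OrdLE 0 x) : x = fn (x.val 0 0) := by
  refine free_ext hf (mono_mem_freeRing _ _) fun i => ?_
  funext n m
  rcases lt_trichotomy i 0 with hi | hi | hi
  · rw [← ha, adj, h (-i) (-0) (by omega)]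
    simp [fn, PDO.mono, hi.ne]
  · simp [fn, PDO.mono, hi]
  · rw [h i 0 hi]
    simp [fn, PDO.mono, hi.ne']

/-! ### The operators `L_j` -/

/-- The selfadjoint operator `D` for which `L_j = D (T₁ - T₁⁻¹)`. -/
def laxSym (j : ℕ) (L : Op K) : Op K := mono (quotD (pow L.val j) 0) 0 0 + ∑ i ∈ Finset.Ico 1 j,
  (mono (quotD (pow L.val j) i) i 0 + mono 1 (-(i : ℤ)) 0 * mono (quotD (pow L.val j) i) 0 0)

/-- The operator `L_j` as an element of `𝒪₁⁺`. -/
def lax (j : ℕ) (L : Op K) : Op K := laxSym j L * S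

theorem val_lax (j : ℕ) (L : Op K) : (lax j L).val = laxOp j L.val := by
  simp only [lax, laxSym, val_mul, val_add, val_sum, val_mono, laxOp, val_S]

theorem laxSym_mem_freeRing (j : ℕ) (L : Op K) : laxSym j L ∈ freeRing K :=
  have m : ∀ r k, mono r k 0 ∈ freeRing K := mono_mem_freeRing
  add_mem (m _ _) (sum_mem fun _ _ => add_mem (m _ _) (mul_mem (m _ _) (m _ _)))

theorem laxSym_mem_diffRing (j : ℕ) (L : Op K) : laxSym j L ∈ diffRing K :=
  have m : ∀ r k l, mono r k l ∈ diffRing K := mono_mem_diffRing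
  add_mem (m _ _ _) (sum_mem fun _ _ => add_mem (m _ _ _) (mul_mem (m _ _ _) (m _ _ _)))

/-- In each summand, f_i T₁^i and T₁^{-i} f_i are adjoint to each other. -/
theorem isAdj_laxSym (j : ℕ) (L : Op K) : IsAdj (laxSym j L) (laxSym j L) := by
  refine (isAdj_fn _).add (IsAdj.sum fun i _ => ?_)
  set f := quotD (pow L.val j) i
  have h1 : mono f i 0 = fn f * mono 1 i 0 := by
    simp [fn, mono_mul_mono]
  have h2 : IsAdj (mono (1 : LatFun K) i 0) (mono 1 (-(i : ℤ)) 0) := adj_mono _ _ _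
  have h3 : IsAdj (mono (1 : LatFun K) (-(i : ℤ)) 0) (mono 1 i 0) := by
    have := adj_mono_one (K := K) (-(i : ℤ)) 0
    simpa [IsAdj] using this
  have h4 := ((isAdj_fn f).mul h2).add (h3.mul (isAdj_fn f))
  rw [add_comm (mono 1 (-(i : ℤ)) 0 * fn f)] at h4
  rw [h1]
  exact h4

theorem lax_mem_diffRing (j : ℕ) (L : Op K) : lax j L ∈ diffRing K :=
  mul_mem (laxSym_mem_diffRing j L) (sub_mem (mono_mem_diffRing _ _ _) (mono_mem_diffRing _ _ _))

/-- Write L^j = Q S. The symmetrization of Q changes only negative powers of T₁, so Q - D_j has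
order at most -1, and S raises the order by one. -/
theorem ordLE_pow_sub_lax {L : Op K} (hL : OrdLE 1 L) (hf : L ∈ freeRing K) (j : ℕ) :
    OrdLE 0 (L ^ j - lax j L) := by
  set f : ℤ → LatFun K := quotD (L ^ j).val with hfdef
  have hN : ∀ i : ℤ, (j : ℤ) < i → (L ^ j).val i 0 = 0 := fun i h => hL.pow j i 0 h
  have hpf : L ^ j ∈ freeRing K := Subring.pow_mem _ hf _
  have hz : ∀ i : ℤ, (j : ℤ) ≤ i → f i = 0 := by
    intro i hi
    funext n m
    simp only [hfdef, quotD]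
    rw [finsum_eq_zero_of_forall_eq_zero]
    · rfl
    · intro l
      rw [hN _ (by omega)]
      rfl
  have hpl : IsPlus (ofCoeffs f) := isPlus_iff.2 ⟨j, 0, fun i k h => by
    by_cases hk : k = 0 <;> simp [ofCoeffs, hk, hz i h.le], fun i k h => by
    have : k ≠ 0 := by rintro rfl; simp at h
    simp [ofCoeffs, this]⟩
  have hQ : L ^ j = mk (ofCoeffs f) hpl * S := by
    ext1
    exact (quotD_mul (L ^ j).val hN hpf).symm
  have hD : laxSym j L = mono (f 0) 0 0 + ∑ i ∈ Finset.Ico 1 j,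
    (mono (f i) i 0 + mono 1 (-(i : ℤ)) 0 * mono (f i) 0 0) := by
    rw [laxSym, ← val_pow]
  -- The summands T₁^{-k} f_k have k ≥ 1 and do not reach the exponents i ≥ 0; for i ≥ j both sides
  -- vanish.
  have hc : ∀ i : ℤ, 0 ≤ i → (laxSym j L).val i 0 = f i := by
    intro i hi
    funext n m
    have e : (laxSym j L).val i 0 n m = (if i = 0 then f 0 n m else 0) +
        ∑ k ∈ Finset.Ico 1 j, if i = k then f k n m else 0 := by
      simp only [hD, val_add, val_sum, Pi.add_apply, Finset.sum_apply]
      congr 1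
      · by_cases h : i = 0 <;> simp [PDO.mono, h]
      · refine Finset.sum_congr rfl fun k hk => ?_
        have hk1 := (Finset.mem_Ico.1 hk).1
        have h1 : ¬ (i = -(k : ℤ)) := by omega
        rw [mono_mul_mono]
        by_cases h : i = k
        · have h2 : ¬ ((k : ℤ) = -(k : ℤ)) := by omega
          simp [PDO.mono, h, h2]
        · simp [PDO.mono, h, h1]
    rw [e]
    obtain ⟨i, rfl⟩ := Int.eq_ofNat_of_zero_le hi
    by_cases h0 : i = 0
    · subst h0
      rw [Finset.sum_eq_zero]
      · simp
      · intro k hk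
        have hk1 := (Finset.mem_Ico.1 hk).1
        rw [if_neg (by omega)]
    · by_cases hj : i < j
      · rw [Finset.sum_eq_single i]
        · simp [h0]
        · intro k _ hk
          rw [if_neg (by omega)]
        · intro h
          simp only [Finset.mem_Ico] at h
          omega
      · rw [hz (i : ℤ) (by omega), Finset.sum_eq_zero]
        · simp [h0]
        · intro k hk
          have hk1 := (Finset.mem_Ico.1 hk).2
          rw [if_neg (by omega)]
  rw [hQ, lax, ← sub_mul]
  have : OrdLE (-1) (mk (ofCoeffs f) hpl - laxSym j L) := by
    intro i k hi
    by_cases hk : k = 0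
    · subst hk
      simp [hc i (by omega), ofCoeffs]
    · simp [laxSym_mem_freeRing j L i k hk, ofCoeffs, hk]
  have hS : OrdLE 1 (S : Op K) := fun i k hi => by
    have h1 : i ≠ 1 := hi.ne'
    have h2 : i ≠ -1 := by omega
    simp [S, T₁, T₁i, PDO.mono, h1, h2]
  simpa using this.mul hS

end Op
end
end DiscreteNV

namespace DiscreteNV

noncomputable section

open PDO

namespace Op

variable {K : Type*} [CommRing K]

/-! ### The operator `H` -/

/-- The operator `H` as an element of `𝒪₁⁺`. -/
def opH (u : LatFun K) : Op K := T₁ * T₂ - fn u * (T₁ - T₂) - 1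

/-- The coefficient of `T₂` in `H`. -/
def lead (u : LatFun K) : Op K := T₁ + fn u

/-- The coefficient of `T₂⁰` in `-H`. -/
def rest (u : LatFun K) : Op K := fn u * T₁ + 1

/-- The adjoint of `lead u`. -/
def leadAdj (u : LatFun K) : Op K := T₁i + fn u

/-- The adjoint of `rest u`. -/
def restAdj (u : LatFun K) : Op K := T₁i * fn u + 1

theorem val_opH (u : LatFun K) : (opH u).val = Hop u := by
  simp only [opH, T₁, T₂, fn, mono_mul_mono, Hop, val_sub, val_mul, val_mono, val_one]
  simp
  rfl

theorem opH_eq (u : LatFun K) : opH u = lead u * T₂ - rest u := by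
  unfold opH lead rest
  noncomm_ring

theorem opH_eq_mono (u : LatFun K) :
    opH u = mono 1 1 1 - mono u 1 0 + mono u 0 1 - mono 1 0 0 := by
  have h1 : (mono 1 1 1 : Op K) = T₁ * T₂ := by simp [T₁, T₂, mono_mul_mono]; rfl
  have h2 : mono u 1 0 = fn u * T₁ := by simp [fn, T₁, mono_mul_mono]
  have h3 : mono u 0 1 = fn u * T₂ := by simp [fn, T₂, mono_mul_mono]
  rw [h1, h2, h3, ← one_def, opH]
  noncomm_ring

theorem isAdj_lead (u : LatFun K) : IsAdj (lead u) (leadAdj u) := isAdj_T₁.add (isAdj_fn u)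
theorem isAdj_leadAdj (u : LatFun K) : IsAdj (leadAdj u) (lead u) := isAdj_T₁i.add (isAdj_fn u)
theorem isAdj_rest (u : LatFun K) : IsAdj (rest u) (restAdj u) :=
  ((isAdj_fn u).mul isAdj_T₁).add isAdj_one
theorem isAdj_restAdj (u : LatFun K) : IsAdj (restAdj u) (rest u) :=
  (isAdj_T₁i.mul (isAdj_fn u)).add isAdj_one

/-- With `S_mul_T₂`, this reduces S and S T₂ to multiples of T₁ - T₂ modulo left multiples of H.
That the factors are adjoint to the coefficients of H is what makes `residue` selfadjoint. -/
theorem S_eq (u : LatFun K) : S = restAdj u * (T₁ - T₂) + T₁i * opH u := by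
  have h : restAdj u * (T₁ - T₂) + T₁i * opH u =
      T₁ - T₂ + (T₁i * T₁) * T₂ - T₁i := by
    unfold restAdj opH
    noncomm_ring
  rw [h, T₁i_mul_T₁, S]
  noncomm_ring

theorem S_mul_T₂ (u : LatFun K) : S * T₂ = leadAdj u * (T₁ - T₂) + opH u := by
  have h : leadAdj u * (T₁ - T₂) + opH u =
      T₁i * T₁ - T₁i * T₂ + T₁ * T₂ - 1 := by
    unfold leadAdj opH
    noncomm_ring
  rw [h, T₁i_mul_T₁, S]
  noncomm_ring

theorem T₂_mul_S : (T₂ * S : Op K) = S * T₂ := by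
  rw [S, mul_sub, sub_mul, T₂_mul_T₁, T₂_mul_T₁i]

/-- The selfadjoint operator that governs `H D (T₁ - T₁⁻¹)` modulo `𝒪 H`. -/
def residue (u : LatFun K) (D : Op K) : Op K :=
  lead u * (T₂ * D * T₂i) * leadAdj u - rest u * D * restAdj u

/-- The quotient of `H D (T₁ - T₁⁻¹)` by `H`. -/
def quotient (u : LatFun K) (D : Op K) : Op K :=
  lead u * (T₂ * D * T₂i) - rest u * D * T₁i

/-- Since T₂ commutes with S, it can be carried past D at the price of conjugating D; then S T₂ and
S are reduced modulo H. -/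
theorem opH_mul (u : LatFun K) (D : Op K) :
    opH u * (D * S) = residue u D * (T₁ - T₂) + quotient u D * opH u := by
  have h1 : opH u * (D * S) = lead u * (T₂ * D * T₂i) * (S * T₂) - rest u * D * S := by
    rw [opH_eq, ← T₂_mul_S]
    have : lead u * (T₂ * D * T₂i) * (T₂ * S) = lead u * (T₂ * D * (T₂i * T₂) * S) := by
      simp only [mul_assoc]
    rw [this, T₂i_mul_T₂]
    noncomm_ring
  have h2 : rest u * D * S = rest u * D * (restAdj u * (T₁ - T₂) + T₁i * opH u) := by
    rw [← S_eq]
  rw [h1, h2, S_mul_T₂ u]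
  unfold residue quotient
  noncomm_ring

theorem isAdj_residue (u : LatFun K) {D : Op K} (h : IsAdj D D) :
    IsAdj (residue u D) (residue u D) := by
  have h1 := ((isAdj_lead u).mul ((isAdj_T₂.mul h).mul isAdj_T₂i)).mul (isAdj_leadAdj u)
  have h2 := ((isAdj_rest u).mul h).mul (isAdj_restAdj u)
  have := h1.sub h2
  simp only [residue, mul_assoc] at this ⊢
  exact this

theorem T₁_mem_freeRing : T₁ ∈ freeRing K := mono_mem_freeRing _ _
theorem T₁i_mem_freeRing : T₁i ∈ freeRing K := mono_mem_freeRing _ _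
theorem fn_mem_freeRing (u : LatFun K) : fn u ∈ freeRing K := mono_mem_freeRing _ _
theorem S_mem_freeRing : S ∈ freeRing K := sub_mem T₁_mem_freeRing T₁i_mem_freeRing
theorem lead_mem_freeRing (u : LatFun K) : lead u ∈ freeRing K :=
  add_mem T₁_mem_freeRing (fn_mem_freeRing u)
theorem rest_mem_freeRing (u : LatFun K) : rest u ∈ freeRing K :=
  add_mem (mul_mem (fn_mem_freeRing u) T₁_mem_freeRing) (one_mem _)
theorem leadAdj_mem_freeRing (u : LatFun K) : leadAdj u ∈ freeRing K :=
  add_mem T₁i_mem_freeRing (fn_mem_freeRing u)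
theorem restAdj_mem_freeRing (u : LatFun K) : restAdj u ∈ freeRing K :=
  add_mem (mul_mem T₁i_mem_freeRing (fn_mem_freeRing u)) (one_mem _)

theorem residue_mem_freeRing (u : LatFun K) {D : Op K} (h : D ∈ freeRing K) :
    residue u D ∈ freeRing K :=
  sub_mem (mul_mem (mul_mem (lead_mem_freeRing u) (free_conj h)) (leadAdj_mem_freeRing u))
    (mul_mem (mul_mem (rest_mem_freeRing u) h) (restAdj_mem_freeRing u))

theorem quotient_mem_freeRing (u : LatFun K) {D : Op K} (h : D ∈ freeRing K) :
    quotient u D ∈ freeRing K :=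
  sub_mem (mul_mem (lead_mem_freeRing u) (free_conj h))
    (mul_mem (mul_mem (rest_mem_freeRing u) h) T₁i_mem_freeRing)

theorem quotient_mem_diffRing (u : LatFun K) {D : Op K} (h : D ∈ diffRing K) :
    quotient u D ∈ diffRing K :=
  have m : ∀ r k l, mono r k l ∈ diffRing K := mono_mem_diffRing
  sub_mem (mul_mem (add_mem (m _ _ _) (m _ _ _)) (mul_mem (mul_mem (m _ _ _) h) (m _ _ _)))
    (mul_mem (mul_mem (add_mem (mul_mem (m _ _ _) (m _ _ _)) (m _ _ _)) h) (m _ _ _))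

theorem mul_opH_apply (x : Op K) (u : LatFun K) (i j n m : ℤ) :
    (x * opH u).val i j n m = x.val (i - 1) (j - 1) n m
      - x.val (i - 1) j n m * u (n + i - 1) (m + j)
      + x.val i (j - 1) n m * u (n + i) (m + j - 1) - x.val i j n m := by
  rw [opH_eq_mono, mul_sub, mul_add, mul_sub]
  simp [mul_mono_apply]

theorem opH_mul_apply (x : Op K) (u : LatFun K) (i j n m : ℤ) :
    (opH u * x).val i j n m = x.val (i - 1) (j - 1) (n + 1) (m + 1)
      - u n m * x.val (i - 1) j (n + 1) m
      + u n m * x.val i (j - 1) n (m + 1) - x.val i j n m := by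
  rw [opH_eq_mono, sub_mul, add_mul, sub_mul]
  simp [mono_mul_apply]

theorem mul_T₁_sub_T₂_apply (x : Op K) (i j n m : ℤ) :
    (x * (T₁ - T₂)).val i j n m = x.val (i - 1) j n m - x.val i (j - 1) n m := by
  rw [mul_sub]
  simp [T₁, T₂, mul_mono_apply]

/-- If `x H` has only terms with `T₂⁰` and `T₂¹`, then `x` does not contain `T₂`. -/
theorem free_of_mul_opH {u : LatFun K} (hu : ∀ n m, IsUnit (u n m)) {x : Op K}
    (h : ∀ i j, j ≠ 0 → j ≠ 1 → (x * opH u).val i j = 0) : x ∈ freeRing K := by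
  obtain ⟨N, M, hb⟩ := x.exists_bdd
  have h' : ∀ i j n m, j ≠ 0 → j ≠ 1 → x.val (i - 1) (j - 1) n m
      - x.val (i - 1) j n m * u (n + i - 1) (m + j)
      + x.val i (j - 1) n m * u (n + i) (m + j - 1) - x.val i j n m = 0 := by
    intro i j n m h0 h1
    rw [← mul_opH_apply, h i j h0 h1]
    rfl
  -- From the top down: once x has no T₂^{j+1}, the part of x H in T₂^{j+1} is x_j T₂^j (T₁ + u) T₂,
  -- and descent in T₁ gives x_j = 0.
  have hpos : ∀ k : ℕ, ∀ j, 1 ≤ j → M - k < j → ∀ i, x.val i j = 0 := by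
    intro k
    induction k with
    | zero => exact fun j hj hM i => hb.2 i j (by rw [abs_of_nonneg (by omega)]; simpa using hM)
    | succ k ih =>
      intro j hj hM
      have hs := ih (j + 1) (by omega) (by push_cast at hM; omega)
      have key : ∀ l : ℕ, ∀ i, N - l < i → x.val i j = 0 := by
        intro l
        induction l with
        | zero => exact fun i hi => hb.1 i j (by simpa using hi)
        | succ l ihl =>
          intro i hi
          funext n m
          have := h' (i + 1) (j + 1) n m (by omega) (by omega)
          rw [hs, hs] at this
          simpa [ihl (i + 1) (by push_cast at hi; omega)] using this
      exact fun i => key (N - i + 1).toNat i (by omega)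
  -- From the bottom up: the part of x H in T₂^j is now -x_j T₂^j (u T₁ + 1), whose leading
  -- coefficient in T₁ is u. Here u must be a unit.
  have hneg : ∀ k : ℕ, ∀ j, j ≤ -1 → j < -M + k → ∀ i, x.val i j = 0 := by
    intro k
    induction k with
    | zero => exact fun j hj hM i => hb.2 i j (by rw [abs_of_neg (by omega)]; simp at hM; omega)
    | succ k ih =>
      intro j hj hM
      have hs := ih (j - 1) (by omega) (by push_cast at hM; omega)
      have key : ∀ l : ℕ, ∀ i, N - l < i → x.val i j = 0 := by
        intro l
        induction l with
        | zero => exact fun i hi => hb.1 i j (by simpa using hi)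
        | succ l ihl =>
          intro i hi
          funext n m
          have := h' (i + 1) j n m (by omega) (by omega)
          rw [hs, hs, ihl (i + 1) (by push_cast at hi; omega)] at this
          simp only [Pi.zero_apply, zero_mul, sub_zero, add_zero, zero_sub, neg_eq_zero,
            add_sub_cancel_right] at this
          exact (hu _ _).mul_left_eq_zero.1 this
      exact fun i => key (N - i + 1).toNat i (by omega)
  intro i j hj
  rcases lt_or_gt_of_ne hj with hj | hj
  · exact hneg (j + M + 1).toNat j (by omega) (by omega) i
  · exact hpos (M - j + 1).toNat j (by omega) (by omega) i

theorem opH_mul_free {u : LatFun K} {x : Op K} (hx : x ∈ freeRing K) (i j : ℤ) (h0 : j ≠ 0)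
    (h1 : j ≠ 1) : (opH u * x).val i j = 0 := by
  funext n m
  rw [opH_mul_apply, hx _ _ h0, hx _ _ h0, hx _ _ (sub_ne_zero.2 h1), hx _ _ (sub_ne_zero.2 h1)]
  simp

theorem mul_T₁_sub_T₂_free {x : Op K} (hx : x ∈ freeRing K) (i j : ℤ) (h0 : j ≠ 0)
    (h1 : j ≠ 1) : (x * (T₁ - T₂)).val i j = 0 := by
  funext n m
  rw [mul_T₁_sub_T₂_apply, hx _ _ h0, hx _ _ (sub_ne_zero.2 h1)]
  simp

/-- The comparison of the two sides of `x H = H N + G (T₁ - T₂)`. -/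
theorem top_of_mul_opH {u : LatFun K} {x N G : Op K} (hx : x ∈ freeRing K) (hN : N ∈ freeRing K)
    (hG : G ∈ freeRing K) (hN0 : OrdLE 0 N)
    (h : x * opH u = opH u * N + G * (T₁ - T₂)) :
    OrdLE 0 G ∧ ∀ n m, G.val 0 0 n m =
      u n m * (N.val 0 0 (n + 1) m - N.val 0 0 (n + 1) (m + 1)) := by
  have e1 : ∀ i n m, x.val (i - 1) 0 n m + x.val i 0 n m * u (n + i) m =
      N.val (i - 1) 0 (n + 1) (m + 1) + u n m * N.val i 0 n (m + 1) - G.val i 0 n m := by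
    intro i n m
    have := congrFun (congrFun (congrFun (congrFun (congrArg val h) i) 1) n) m
    rw [val_add, mul_opH_apply] at this
    simp only [Pi.add_apply] at this
    rw [opH_mul_apply, mul_T₁_sub_T₂_apply, hx _ 1 one_ne_zero, hN _ 1 one_ne_zero,
      hG _ 1 one_ne_zero, hx _ 1 one_ne_zero, hN _ 1 one_ne_zero] at this
    simpa [sub_eq_add_neg] using this
  have e0 : ∀ i n m, x.val (i - 1) 0 n m * u (n + i - 1) m + x.val i 0 n m =
      u n m * N.val (i - 1) 0 (n + 1) m + N.val i 0 n m - G.val (i - 1) 0 n m := by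
    intro i n m
    have := congrFun (congrFun (congrFun (congrFun (congrArg val h) i) 0) n) m
    rw [val_add, mul_opH_apply] at this
    simp only [Pi.add_apply] at this
    have h1 : (0 - 1 : ℤ) ≠ 0 := by norm_num
    rw [opH_mul_apply, mul_T₁_sub_T₂_apply, hx _ _ h1, hN _ _ h1, hG _ _ h1, hx _ _ h1,
      hN _ _ h1] at this
    simp only [Pi.zero_apply, add_zero, zero_mul, mul_zero, zero_sub, sub_zero] at this
    linear_combination -this
  obtain ⟨N₁, -, hb₁, -⟩ := x.exists_bdd
  obtain ⟨N₂, -, hb₂, -⟩ := G.exists_bdd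
  set B := max N₁ N₂
  -- For i ≥ 1 the operator N contributes nothing, so the T₂-part kills x_i and then the T₂⁰-part
  -- kills G_i.
  have key : ∀ k : ℕ, ∀ i, B - k < i → 1 ≤ i → x.val i 0 = 0 ∧ G.val i 0 = 0 := by
    intro k
    induction k with
    | zero =>
      intro i hi _
      simp only [Nat.cast_zero, sub_zero] at hi
      exact ⟨hb₁ i 0 ((le_max_left _ _).trans_lt hi), hb₂ i 0 ((le_max_right _ _).trans_lt hi)⟩
    | succ k ih =>
      intro i hi h1
      obtain ⟨a1, a2⟩ := ih (i + 1) (by push_cast at hi; omega) (by omega)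
      have ax : x.val i 0 = 0 := by
        funext n m
        have := e1 (i + 1) n m
        rw [a1, a2, hN0 (i + 1) 0 (by omega), hN0 (i + 1 - 1) 0 (by omega)] at this
        simpa using this
      refine ⟨ax, ?_⟩
      funext n m
      have := e0 (i + 1) n m
      rw [a1, hN0 (i + 1) 0 (by omega), hN0 (i + 1 - 1) 0 (by omega)] at this
      simpa [ax] using this
  have key' : ∀ i, 1 ≤ i → x.val i 0 = 0 ∧ G.val i 0 = 0 := fun i hi =>
    key (B - i + 1).toNat i (by omega) hi
  constructor
  · intro i j hi
    by_cases hj : j = 0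
    · rw [hj, (key' i hi).2]
    · exact hG i j hj
  · intro n m
    -- The T₂-part gives x₀ = N₀(n+1, m+1); inserting it into the T₂⁰-part yields G₀.
    have h1 := e1 1 n m
    have h0 := e0 1 n m
    rw [(key' 1 le_rfl).1, (key' 1 le_rfl).2, hN0 1 0 one_pos] at h1
    rw [(key' 1 le_rfl).1, hN0 1 0 one_pos] at h0
    simp only [sub_self, Pi.zero_apply, zero_mul, add_zero, mul_zero, sub_zero,
      add_sub_cancel_right] at h0 h1
    rw [h1] at h0
    linear_combination h0

/-- The case N = 0 of the comparison. It makes ∂H, which has the form -w (T₁ - T₂), determined by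
its class modulo 𝒪_H. -/
theorem eq_zero_of_mul_opH {u w : LatFun K} (hu : ∀ n m, IsUnit (u n m)) {x : Op K}
    (h : x * opH u = fn w * (T₁ - T₂)) : w = 0 := by
  have hf : x ∈ freeRing K := free_of_mul_opH hu fun i j h0 h1 => by
    rw [h, mul_T₁_sub_T₂_free (fn_mem_freeRing w) i j h0 h1]
  have := (top_of_mul_opH (N := 0) hf (Subring.zero_mem _) (fn_mem_freeRing w)
    (fun _ _ _ => rfl) (by simpa using h)).2
  funext n m
  simpa [fn, PDO.mono] using this n m

/-- From [H, L] = E H one gets H L = (E + L) H; the left side has only T₂⁰ and T₂¹, so e = E + L is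
free of T₂. -/
theorem exists_free_quotient {u : LatFun K} (hu : ∀ n m, IsUnit (u n m)) {L : Op K}
    (hf : L ∈ freeRing K) (h : MemIdealPlus (Hop u) (bracket (Hop u) L.val)) :
    ∃ e ∈ freeRing K, opH u * L = e * opH u := by
  obtain ⟨E, hE, h⟩ := h
  have h1 : opH u * L = (mk E hE + L) * opH u := by
    have : opH u * L - L * opH u = mk E hE * opH u := by
      ext1
      rw [val_bracket, val_opH, h, val_mul, val_opH, val_mk]
    rw [add_mul, ← this]
    abel
  exact ⟨_, free_of_mul_opH hu fun i j h0 h1' => by rw [← h1, opH_mul_free hf i j h0 h1'], h1⟩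

/-- The coefficient of `T₁⁰` in `𝓛^j - L_j`. -/
def subCoeff (j : ℕ) (L : PDO K) : LatFun K := (pow L j - laxOp j L) 0 0

/-- The logarithmic derivative of `u` along the `j`-th flow. -/
def logDer (j : ℕ) (L : PDO K) : LatFun K := fun n m =>
  subCoeff j L (n + 1) m - subCoeff j L (n + 1) (m + 1)

theorem logDer_eq (j : ℕ) (L : Op K) (n m : ℤ) : logDer j L.val n m =
    (L ^ j - lax j L).val 0 0 (n + 1) m - (L ^ j - lax j L).val 0 0 (n + 1) (m + 1) := by
  simp only [logDer, subCoeff, val_sub, val_pow, val_lax]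

theorem lax_mem_freeRing (j : ℕ) (L : Op K) : lax j L ∈ freeRing K :=
  mul_mem (laxSym_mem_freeRing j L) S_mem_freeRing

/-- Since H L^j = e^j H, the residue occurs in a relation x H = H N + G (T₁ - T₂) with N of order at
most 0. So G has order at most 0, and being selfadjoint it is a function. -/
theorem residue_eq {u : LatFun K} {L e : Op K} (j : ℕ) (hL : OrdLE 1 L)
    (hf : L ∈ freeRing K) (he : opH u * L = e * opH u) (hef : e ∈ freeRing K) :
    residue u (laxSym j L) = fn (u * logDer j L.val) := by
  have hp : opH u * L ^ j = e ^ j * opH u := (SemiconjBy.pow_right he j : _)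
  have hx : (e ^ j - quotient u (laxSym j L)) * opH u =
      opH u * (L ^ j - lax j L) + residue u (laxSym j L) * (T₁ - T₂) := by
    rw [sub_mul, mul_sub, lax, opH_mul, hp]
    abel
  have hN : L ^ j - lax j L ∈ freeRing K := sub_mem (pow_mem hf j) (lax_mem_freeRing j L)
  have hG := residue_mem_freeRing u (laxSym_mem_freeRing j L)
  obtain ⟨t1, t2⟩ := top_of_mul_opH (sub_mem (pow_mem hef j)
    (quotient_mem_freeRing u (laxSym_mem_freeRing j L))) hN hG (ordLE_pow_sub_lax hL hf j) hx
  rw [eq_fn_of_isAdj hG (isAdj_residue u (isAdj_laxSym j L)) t1]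
  congr 1
  funext n m
  rw [t2 n m, Pi.mul_apply, Pi.mul_apply, logDer_eq]

/-- `H L_j ≡ (∂u) (T₁ - T₂)` modulo `𝒪 H`. -/
theorem opH_mul_lax {u : LatFun K} {L e : Op K} (j : ℕ) (hL : OrdLE 1 L)
    (hf : L ∈ freeRing K) (he : opH u * L = e * opH u) (hef : e ∈ freeRing K) :
    opH u * lax j L = fn (u * logDer j L.val) * (T₁ - T₂) + quotient u (laxSym j L) * opH u := by
  rw [lax, opH_mul, residue_eq j hL hf he hef]

end Op
end
end DiscreteNV

namespace DiscreteNV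

noncomputable section

open PDO

/-! ### Change of coefficients -/

/-- `δ` is a derivation along the ring homomorphism `ρ`. -/
structure IsDer {A B : Type*} [CommRing A] [CommRing B] (ρ : A →+* B) (δ : A →+ B) : Prop where
  leibniz : ∀ a b, δ (a * b) = ρ a * δ b + δ a * ρ b

theorem IsDer.map_one {A B : Type*} [CommRing A] [CommRing B] {ρ : A →+* B} {δ : A →+ B}
    (h : IsDer ρ δ) : δ 1 = 0 := by
  simpa using h.leibniz 1 1

namespace Op

variable {A B : Type*} [CommRing A] [CommRing B]

/-- Application of an additive map to all coefficients. -/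
def opMap (f : A →+ B) : Op A →+ Op B where
  toFun x := mk (PDO.map f x.val) (by
    obtain ⟨N, M, h⟩ := x.exists_bdd
    exact isPlus_iff.2 ⟨N, M, fun i j hi => by funext n m; simp [PDO.map, h.1 i j hi],
      fun i j hi => by funext n m; simp [PDO.map, h.2 i j hi]⟩)
  map_zero' := by ext i j n m; simp [PDO.map]
  map_add' x y := by ext i j n m; simp [PDO.map]

theorem val_opMap (f : A →+ B) (x : Op A) : (opMap f x).val = PDO.map f x.val := rfl

theorem opMap_apply (f : A →+ B) (x : Op A) (i j n m : ℤ) :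
    (opMap f x).val i j n m = f (x.val i j n m) := rfl

theorem opMap_mono (f : A →+ B) (r : LatFun A) (k l : ℤ) :
    opMap f (mono r k l) = mono (fun n m => f (r n m)) k l := by
  ext i j n m
  by_cases h : i = k ∧ j = l <;> simp [opMap_apply, PDO.mono, h]

theorem common_map (x y : Op A) : ∃ N M, Bdd N M x.val ∧ Bdd N M y.val ∧
    (∀ g : A →+ B, Bdd N M (opMap g x).val) ∧ ∀ g : A →+ B, Bdd N M (opMap g y).val := by
  obtain ⟨N, M, hx, hy⟩ := bdd_common x.isPlus y.isPlus
  refine ⟨N, M, hx, hy, fun g => ⟨fun i j h => ?_, fun i j h => ?_⟩,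
    fun g => ⟨fun i j h => ?_, fun i j h => ?_⟩⟩ <;> funext n m <;> rw [opMap_apply]
  · simp [hx.1 i j h]
  · simp [hx.2 i j h]
  · simp [hy.1 i j h]
  · simp [hy.2 i j h]

/-- Application of a ring homomorphism to all coefficients. -/
def opHom (ρ : A →+* B) : Op A →+* Op B where
  __ := opMap (ρ : A →+ B)
  map_one' := by
    show opMap _ (mono _ _ _) = mono _ _ _
    rw [opMap_mono]
    simp
    rfl
  map_mul' x y := by
    obtain ⟨N, M, hx, hy, hx', hy'⟩ := common_map (B := B) x y
    ext i j n m
    show ρ ((x * y).val i j n m) =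
      PDO.mul (opMap (ρ : A →+ B) x).val (opMap (ρ : A →+ B) y).val i j n m
    rw [mul_eq_box (hx' _) (hy' _), val_mul, mul_eq_box hx hy, map_sum]
    simp [opMap_apply]

theorem opHom_apply (ρ : A →+* B) (x : Op A) (i j n m : ℤ) :
    (opHom ρ x).val i j n m = ρ (x.val i j n m) := rfl

theorem opMap_mul {ρ : A →+* B} {δ : A →+ B} (h : IsDer ρ δ) (x y : Op A) :
    opMap δ (x * y) = opHom ρ x * opMap δ y + opMap δ x * opHom ρ y := by
  obtain ⟨N, M, hx, hy, hx', hy'⟩ := common_map (B := B) x y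
  ext i j n m
  rw [opMap_apply, val_add, val_mul, val_mul, val_mul]
  simp only [Pi.add_apply]
  have hρ : ∀ z : Op A, opHom ρ z = opMap (ρ : A →+ B) z := fun _ => rfl
  rw [hρ, hρ, mul_eq_box (hx' _) (hy' _), mul_eq_box (hx' _) (hy' _), mul_eq_box hx hy, map_sum,
    ← Finset.sum_add_distrib]
  exact Finset.sum_congr rfl fun p _ => h.leibniz _ _

theorem opHom_mono (ρ : A →+* B) (r : LatFun A) (k l : ℤ) :
    opHom ρ (mono r k l) = mono (fun n m => ρ (r n m)) k l :=
  opMap_mono (ρ : A →+ B) r k l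

theorem opHom_mono_one (ρ : A →+* B) (k l : ℤ) : opHom ρ (mono 1 k l) = mono 1 k l := by
  rw [opHom_mono]
  simp
  rfl

theorem opMap_mono_one {ρ : A →+* B} {δ : A →+ B} (h : IsDer ρ δ) (k l : ℤ) :
    opMap δ (mono 1 k l) = 0 := by
  rw [opMap_mono]
  ext i j n m
  by_cases h' : i = k ∧ j = l <;> simp [PDO.mono, h', h.map_one]

theorem opHom_S (ρ : A →+* B) : opHom ρ S = S := by
  rw [S, map_sub, T₁, T₁i, opHom_mono_one, opHom_mono_one]
  rfl

theorem opMap_S {ρ : A →+* B} {δ : A →+ B} (h : IsDer ρ δ) : opMap δ S = 0 := by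
  rw [S, map_sub, T₁, T₁i, opMap_mono_one h, opMap_mono_one h, sub_zero]

theorem opHom_opH (ρ : A →+* B) (u : LatFun A) :
    opHom ρ (opH u) = opH (fun n m => ρ (u n m)) := by
  simp only [opH, map_sub, map_mul, map_one, T₁, T₂, opHom_mono_one, fn]
  rw [opHom_mono]

theorem opMap_opH {ρ : A →+* B} {δ : A →+ B} (h : IsDer ρ δ) (u : LatFun A) :
    opMap δ (opH u) = -(fn (fun n m => δ (u n m)) * (T₁ - T₂)) := by
  simp only [opH, map_sub, opMap_mul h, T₁, T₂, fn, one_def, opMap_mono_one h, opHom_mono_one,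
    opMap_mono]
  noncomm_ring

theorem opMap_free {f : A →+ B} {x : Op A} (hx : x ∈ freeRing A) : opMap f x ∈ freeRing B := by
  intro i j h
  funext n m
  rw [opMap_apply, hx i j h]
  simp

theorem opHom_free {ρ : A →+* B} {x : Op A} (hx : x ∈ freeRing A) : opHom ρ x ∈ freeRing B :=
  opMap_free (f := (ρ : A →+ B)) hx

theorem OrdLE.opMap {d : ℤ} {x : Op A} (hx : OrdLE d x) (f : A →+ B) : OrdLE d (opMap f x) := by
  intro i j h
  funext n m
  rw [opMap_apply, hx i j h]
  simp

theorem OrdLE.opHom {d : ℤ} {x : Op A} (hx : OrdLE d x) (ρ : A →+* B) : OrdLE d (opHom ρ x) :=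
  hx.opMap (ρ : A →+ B)

theorem IsAdj.opMap {x y : Op A} (h : IsAdj x y) (f : A →+ B) :
    IsAdj (opMap f x) (opMap f y) := by
  unfold IsAdj at *
  rw [val_opMap, val_opMap, ← h]
  rfl

theorem IsAdj.opHom {x y : Op A} (h : IsAdj x y) (ρ : A →+* B) :
    IsAdj (opHom ρ x) (opHom ρ y) := h.opMap (ρ : A →+ B)

/-- By rigidity applied to the difference. It yields naturality of L_j in the coefficient ring
without the explicit formula. -/
theorem laxSym_unique {L D : Op A} {j : ℕ} (hL : OrdLE 1 L) (hf : L ∈ freeRing A)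
    (hD : D ∈ freeRing A) (ha : IsAdj D D) (h : OrdLE 0 (L ^ j - D * S)) : D = laxSym j L := by
  rw [← sub_eq_zero]
  refine eq_zero_of_isAdj (sub_mem hD (laxSym_mem_freeRing j L)) (ha.sub (isAdj_laxSym j L)) ?_
  have := (ordLE_pow_sub_lax hL hf j).sub h
  rwa [show L ^ j - lax j L - (L ^ j - D * S) = (D - laxSym j L) * S by
    rw [lax]; noncomm_ring] at this

theorem opHom_lax (ρ : A →+* B) {L : Op A} (hL : OrdLE 1 L) (hf : L ∈ freeRing A) (j : ℕ) :
    opHom ρ (lax j L) = lax j (opHom ρ L) := by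
  have : opHom ρ (laxSym j L) = laxSym j (opHom ρ L) := by
    refine laxSym_unique (hL.opHom ρ) (opHom_free hf) (opHom_free (laxSym_mem_freeRing j L))
      ((isAdj_laxSym j L).opHom ρ) ?_
    have := (ordLE_pow_sub_lax hL hf j).opHom ρ
    rwa [map_sub, lax, map_mul, opHom_S, map_pow] at this
  rw [lax, lax, map_mul, opHom_S, this]

theorem logDer_opHom (ρ : A →+* B) {L : Op A} (hL : OrdLE 1 L) (hf : L ∈ freeRing A) (j : ℕ)
    (n m : ℤ) : logDer j (opHom ρ L).val n m = ρ (logDer j L.val n m) := by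
  rw [logDer_eq, logDer_eq, ← opHom_lax ρ hL hf, ← map_pow, ← map_sub, opHom_apply, opHom_apply,
    map_sub]

/-! ### The vector field -/

/-- The derivative `[L_j, 𝓛]` of `𝓛` along the `j`-th flow. -/
def field (j : ℕ) (L : Op A) : Op A := lax j L * L - L * lax j L

theorem val_field (j : ℕ) (L : Op A) : (field j L).val = bracket (laxOp j L.val) L.val := by
  rw [field, val_bracket, val_lax]

/-- Because L commutes with L^j, the field is also a commutator with an operator of order at most 0;
hence it does not raise the order of L, and its leading coefficient is computable. -/
theorem field_eq (j : ℕ) (L : Op A) :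
    field j L = L * (L ^ j - lax j L) - (L ^ j - lax j L) * L := by
  have : L * L ^ j = L ^ j * L := (Commute.self_pow L j).eq
  rw [field, mul_sub, sub_mul, this]
  abel

theorem field_mem_freeRing {L : Op A} (hf : L ∈ freeRing A) (j : ℕ) : field j L ∈ freeRing A :=
  sub_mem (mul_mem (lax_mem_freeRing j L) hf) (mul_mem hf (lax_mem_freeRing j L))

theorem ordLE_field {L : Op A} (hL : OrdLE 1 L) (hf : L ∈ freeRing A) (j : ℕ) :
    OrdLE 1 (field j L) := by
  rw [field_eq]
  have := ordLE_pow_sub_lax hL hf j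
  exact (by simpa using hL.mul this : OrdLE 1 _).sub (by simpa using this.mul hL)

theorem field_top {L : Op A} (hL : OrdLE 1 L) (hf : L ∈ freeRing A) (j : ℕ) (n m : ℤ) :
    (field j L).val 1 0 n m = L.val 1 0 n m *
      (subCoeff j L.val (n + 1) m - subCoeff j L.val n m) := by
  have h0 := ordLE_pow_sub_lax hL hf j
  have hN : L ^ j - lax j L ∈ freeRing A := sub_mem (pow_mem hf j) (lax_mem_freeRing j L)
  have h1 := top_coeff hL h0 hf n m
  have h2 := top_coeff h0 hL hN n m
  have h3 : subCoeff j L.val = (L ^ j - lax j L).val 0 0 := by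
    simp only [subCoeff, val_sub, val_pow, val_lax]
  rw [field_eq, val_sub, h3]
  simp only [Pi.sub_apply, add_zero, zero_add] at *
  rw [h1, h2]
  ring

theorem opHom_field (ρ : A →+* B) {L : Op A} (hL : OrdLE 1 L) (hf : L ∈ freeRing A) (j : ℕ) :
    opHom ρ (field j L) = field j (opHom ρ L) := by
  simp only [field, map_sub, map_mul, opHom_lax ρ hL hf]

theorem opMap_pow {ρ : A →+* B} {δ : A →+ B} (h : IsDer ρ δ) {L : Op A} {Q : Op B}
    (hQ : opMap δ L = Q * opHom ρ L - opHom ρ L * Q) (j : ℕ) :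
    opMap δ (L ^ j) = Q * opHom ρ L ^ j - opHom ρ L ^ j * Q := by
  induction j with
  | zero =>
    rw [pow_zero, pow_zero, one_def, opMap_mono_one h, mul_one, one_mul, sub_self]
  | succ j ih =>
    rw [pow_succ, opMap_mul h, ih, hQ, map_pow, pow_succ]
    noncomm_ring

/-! ### Zero curvature and commutation of the derivatives -/

section commute

variable {A' : Type*} [CommRing A'] {ρ : A →+* B} {δ : A →+ B} {ρ' : A' →+* B} {δ' : A' →+ B}
  {L : Op A} {L' : Op A'} {i j : ℕ}

/-- The zero curvature equation. -/
theorem zero_curvature (h : IsDer ρ δ) (h' : IsDer ρ' δ') (hL : OrdLE 1 L)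
    (hf : L ∈ freeRing A) (hL' : OrdLE 1 L') (hf' : L' ∈ freeRing A')
    (hLL : opHom ρ L = opHom ρ' L') (hi : opMap δ L = field i (opHom ρ L))
    (hj : opMap δ' L' = field j (opHom ρ L)) :
    opMap δ (lax j L) - opMap δ' (lax i L') = lax i (opHom ρ L) * lax j (opHom ρ L)
      - lax j (opHom ρ L) * lax i (opHom ρ L) ∧
    opMap δ (L ^ j - lax j L) - opMap δ' (L' ^ i - lax i L') =
      (opHom ρ L ^ j - lax j (opHom ρ L)) * (opHom ρ L ^ i - lax i (opHom ρ L)) -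
      (opHom ρ L ^ i - lax i (opHom ρ L)) * (opHom ρ L ^ j - lax j (opHom ρ L)) := by
  have p1 := opMap_pow h hi j
  have p2 := opMap_pow h' (hLL ▸ hj) i
  rw [← hLL] at p2
  set M := opHom ρ L
  have hM : OrdLE 1 M := hL.opHom ρ
  have hMf : M ∈ freeRing B := opHom_free hf
  set P := lax i M with hP
  set Q := lax j M with hQ
  have hc : M ^ i * M ^ j = M ^ j * M ^ i := (Commute.pow_pow_self M i j).eq
  have n1 := (ordLE_pow_sub_lax hL hf j).opMap δ
  have n2 := (ordLE_pow_sub_lax hL' hf' i).opMap δ'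
  have n3 : OrdLE 0 ((M ^ i - P) * (M ^ j - Q)) := by
    simpa using (ordLE_pow_sub_lax hM hMf i).mul (ordLE_pow_sub_lax hM hMf j)
  have n4 : OrdLE 0 ((M ^ j - Q) * (M ^ i - P)) := by
    simpa using (ordLE_pow_sub_lax hM hMf j).mul (ordLE_pow_sub_lax hM hMf i)
  -- The curvature defect is D S, since S has constant coefficients. Since S is skew, D_i S D_j -
  -- D_j S D_i is selfadjoint, and so is D.
  set D := opMap δ (laxSym j L) - opMap δ' (laxSym i L') -
    (laxSym i M * S * laxSym j M - laxSym j M * S * laxSym i M) with hD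
  have hDS : D * S = opMap δ (lax j L) - opMap δ' (lax i L') - (P * Q - Q * P) := by
    rw [hD, lax, lax, opMap_mul h, opMap_mul h', opMap_S h, opMap_S h', opHom_S, opHom_S, hP, hQ,
      lax, lax]
    noncomm_ring
  -- The derivatives of M^j and M^i are commutators with P and Q, and the powers commute, so only
  -- operators of order at most 0 remain.
  have e : opMap δ (lax j L) - opMap δ' (lax i L') - (P * Q - Q * P) =
      (M ^ j - Q) * (M ^ i - P) - (M ^ i - P) * (M ^ j - Q)
      - opMap δ (L ^ j - lax j L) + opMap δ' (L' ^ i - lax i L') := by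
    rw [map_sub, map_sub, p1, p2]
    simp only [mul_sub, sub_mul, hc]
    abel
  have ha : IsAdj D D := by
    have a1 := ((isAdj_laxSym j L).opMap δ).sub ((isAdj_laxSym i L').opMap δ')
    have a2 := ((isAdj_laxSym i M).mul isAdj_S).mul (isAdj_laxSym j M)
    have a3 := ((isAdj_laxSym j M).mul isAdj_S).mul (isAdj_laxSym i M)
    have := a1.sub (a2.sub a3)
    rwa [show opMap δ (laxSym j L) - opMap δ' (laxSym i L') -
      (laxSym j M * (-S * laxSym i M) - laxSym i M * (-S * laxSym j M)) = D by
        rw [hD]; noncomm_ring] at this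
  have hfr : D ∈ freeRing B := by
    have m1 := laxSym_mem_freeRing i M
    have m2 := laxSym_mem_freeRing j M
    have m3 := S_mem_freeRing (K := B)
    exact sub_mem (sub_mem (opMap_free (laxSym_mem_freeRing j L))
      (opMap_free (laxSym_mem_freeRing i L')))
      (sub_mem (mul_mem (mul_mem m1 m3) m2) (mul_mem (mul_mem m2 m3) m1))
  have hz : D = 0 := by
    refine eq_zero_of_isAdj hfr ha ?_
    rw [hDS, e]
    exact ((n4.sub n3).sub n1).add n2
  rw [hz, zero_mul] at hDS
  constructor
  · rw [← sub_eq_zero, ← hDS]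
  · rw [e] at hDS
    rw [← sub_eq_zero, ← neg_eq_zero, hDS]
    abel

/-- The Jacobi identity turns zero curvature for the L_j into equality of the mixed derivatives of
𝓛. -/
theorem opMap_field_comm (h : IsDer ρ δ) (h' : IsDer ρ' δ') (hL : OrdLE 1 L)
    (hf : L ∈ freeRing A) (hL' : OrdLE 1 L') (hf' : L' ∈ freeRing A')
    (hLL : opHom ρ L = opHom ρ' L') (hi : opMap δ L = field i (opHom ρ L))
    (hj : opMap δ' L' = field j (opHom ρ L)) :
    opMap δ (field j L) = opMap δ' (field i L') := by
  have z := (zero_curvature h h' hL hf hL' hf' hLL hi hj).1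
  rw [sub_eq_iff_eq_add] at z
  simp only [field, map_sub, opMap_mul h, opMap_mul h', opHom_lax ρ hL hf, opHom_lax ρ' hL' hf',
    hi, hj, z, ← hLL]
  noncomm_ring

/-- The coefficient of T₁⁰ in a commutator of two operators of order at most 0 vanishes, because
functions commute; so the order-0 part of zero curvature is ∂_i g_j = ∂_j g_i. -/
theorem logDer_comm (h : IsDer ρ δ) (h' : IsDer ρ' δ') (hL : OrdLE 1 L)
    (hf : L ∈ freeRing A) (hL' : OrdLE 1 L') (hf' : L' ∈ freeRing A')
    (hLL : opHom ρ L = opHom ρ' L') (hi : opMap δ L = field i (opHom ρ L))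
    (hj : opMap δ' L' = field j (opHom ρ L)) (n m : ℤ) :
    δ (logDer j L.val n m) = δ' (logDer i L'.val n m) := by
  have z := (zero_curvature h h' hL hf hL' hf' hLL hi hj).2
  set M := opHom ρ L
  have hM : OrdLE 1 M := hL.opHom ρ
  have hMf : M ∈ freeRing B := opHom_free hf
  have hN : ∀ k, M ^ k - lax k M ∈ freeRing B := fun k =>
    sub_mem (pow_mem hMf k) (lax_mem_freeRing k M)
  have key : ∀ n m, δ ((L ^ j - lax j L).val 0 0 n m) = δ' ((L' ^ i - lax i L').val 0 0 n m) := by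
    intro n m
    have := congrFun (congrFun (congrFun (congrFun (congrArg val z) 0) 0) n) m
    have t1 := top_coeff (ordLE_pow_sub_lax hM hMf j) (ordLE_pow_sub_lax hM hMf i) (hN j) n m
    have t2 := top_coeff (ordLE_pow_sub_lax hM hMf i) (ordLE_pow_sub_lax hM hMf j) (hN i) n m
    rw [val_sub, val_sub] at this
    simp only [Pi.sub_apply] at this
    rw [add_zero] at t1 t2
    rw [t1, t2, opMap_apply, opMap_apply, add_zero, mul_comm, sub_self, sub_eq_zero] at this
    exact this
  rw [logDer_eq, logDer_eq, map_sub, map_sub, key, key]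

end commute

end Op
end
end DiscreteNV

namespace DiscreteNV

noncomputable section

open PDO

/-! ### The `τ`-function -/

section tau

variable {A B : Type*} [CommRing A] [CommRing B] {ρ : A →+* B} {δ : A →+ B}

/-- `α` is the logarithmic derivative of the unit `a`. -/
def HasLogDer (ρ : A →+* B) (δ : A →+ B) (a : Aˣ) (α : B) : Prop := δ a = ρ a * α

theorem HasLogDer.mul (h : IsDer ρ δ) {a b : Aˣ} {α β : B} (ha : HasLogDer ρ δ a α)
    (hb : HasLogDer ρ δ b β) : HasLogDer ρ δ (a * b) (α + β) := by
  unfold HasLogDer at *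
  rw [Units.val_mul, h.leibniz, ha, hb, map_mul]
  ring

theorem HasLogDer.inv (h : IsDer ρ δ) {a : Aˣ} {α : B} (ha : HasLogDer ρ δ a α) :
    HasLogDer ρ δ a⁻¹ (-α) := by
  unfold HasLogDer at *
  have h1 := h.leibniz a ((a⁻¹ : Aˣ) : A)
  have h2 : ρ a * ρ ((a⁻¹ : Aˣ) : A) = 1 := by
    rw [← map_mul, Units.mul_inv, map_one]
  rw [Units.mul_inv, h.map_one, ha] at h1
  linear_combination (-(ρ ((a⁻¹ : Aˣ) : A))) * h1 + (-δ ((a⁻¹ : Aˣ) : A)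
    - ρ ((a⁻¹ : Aˣ) : A) * α) * h2

theorem HasLogDer.div (h : IsDer ρ δ) {a b : Aˣ} {α β : B} (ha : HasLogDer ρ δ a α)
    (hb : HasLogDer ρ δ b β) : HasLogDer ρ δ (a / b) (α - β) := by
  rw [div_eq_mul_inv, sub_eq_add_neg]
  exact ha.mul h (hb.inv h)

/-- `(t₁τ)(t₂τ) / ((t₁t₂τ) τ)`. -/
def tauU (τ : ℤ → ℤ → Aˣ) (n m : ℤ) : Aˣ :=
  τ (n + 1) m * τ n (m + 1) / (τ (n + 1) (m + 1) * τ n m)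

/-- `(t₁τ)(t₁⁻¹τ) / τ²`. -/
def tauV (τ : ℤ → ℤ → Aˣ) (n m : ℤ) : Aˣ := τ (n + 1) m * τ (n - 1) m / τ n m ^ 2

theorem hasLogDer_tauU (h : IsDer ρ δ) {τ : ℤ → ℤ → Aˣ} {φ : ℤ → ℤ → B}
    (hτ : ∀ n m, HasLogDer ρ δ (τ n m) (φ n m)) (n m : ℤ) : HasLogDer ρ δ (tauU τ n m)
    (φ (n + 1) m + φ n (m + 1) - (φ (n + 1) (m + 1) + φ n m)) :=
  ((hτ _ _).mul h (hτ _ _)).div h ((hτ _ _).mul h (hτ _ _))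

theorem hasLogDer_tauV (h : IsDer ρ δ) {τ : ℤ → ℤ → Aˣ} {φ : ℤ → ℤ → B}
    (hτ : ∀ n m, HasLogDer ρ δ (τ n m) (φ n m)) (n m : ℤ) : HasLogDer ρ δ (tauV τ n m)
    (φ (n + 1) m + φ (n - 1) m - (φ n m + φ n m)) := by
  rw [tauV, sq]
  exact ((hτ _ _).mul h (hτ _ _)).div h ((hτ _ _).mul h (hτ _ _))

theorem map_tauU (ρ : A →+* B) (τ : ℤ → ℤ → Aˣ) (n m : ℤ) :
    ρ (tauU τ n m : A) = (tauU (fun n m => Units.map (ρ : A →* B) (τ n m)) n m : B) := by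
  have : tauU (fun n m => Units.map (ρ : A →* B) (τ n m)) n m =
      Units.map (ρ : A →* B) (tauU τ n m) := by
    simp only [tauU, map_mul, map_div]
  rw [this]
  rfl

theorem map_tauV (ρ : A →+* B) (τ : ℤ → ℤ → Aˣ) (n m : ℤ) :
    ρ (tauV τ n m : A) = (tauV (fun n m => Units.map (ρ : A →* B) (τ n m)) n m : B) := by
  have : tauV (fun n m => Units.map (ρ : A →* B) (τ n m)) n m =
      Units.map (ρ : A →* B) (tauV τ n m) := by
    simp only [tauV, map_mul, map_div, map_pow]
  rw [this]
  rfl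

theorem ansatz_iff {K : Type*} [CommRing K] [Algebra ℂ K] {u v : LatFun K} : Ansatz u v ↔
    ∃ (C : ℂ) (τ : ℤ → ℤ → Kˣ), C ≠ 0 ∧ (∀ n m, u n m = algebraMap ℂ K C * (tauU τ n m : K)) ∧
      ∀ n m, v n m = (tauV τ n m : K) :=
  ⟨fun ⟨C, τ, hC, h⟩ => ⟨C, τ, hC, fun n m => (h n m).1, fun n m => (h n m).2⟩,
    fun ⟨C, τ, hC, h, h'⟩ => ⟨C, τ, hC, fun n m => ⟨h n m, h' n m⟩⟩⟩

theorem Ansatz.isUnit {K : Type*} [CommRing K] [Algebra ℂ K] {u v : LatFun K}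
    (h : Ansatz u v) (n m : ℤ) : IsUnit (u n m) := by
  obtain ⟨C, τ, hC, h, -⟩ := ansatz_iff.1 h
  rw [h]
  exact ((IsUnit.mk0 C hC).map _).mul (Units.isUnit _)

/-- A discrete antiderivative with value 0 at 0; of the two sums at least one is empty, according to
the sign of n. -/
theorem exists_sub_eq (g : ℤ → A) : ∃ φ : ℤ → A, ∀ n, φ n - φ (n - 1) = g n := by
  refine ⟨fun n => ∑ k ∈ Finset.Ioc 0 n, g k - ∑ k ∈ Finset.Ioc n 0, g k, fun n => ?_⟩
  beta_reduce
  rcases le_or_gt 1 n with h | h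
  · have : Finset.Ioc 0 n = insert n (Finset.Ioc 0 (n - 1)) := by
      ext k
      simp only [Finset.mem_Ioc, Finset.mem_insert]
      omega
    rw [this, Finset.sum_insert (by simp), Finset.Ioc_eq_empty (by omega : ¬ n < 0),
      Finset.Ioc_eq_empty (by omega : ¬ n - 1 < 0)]
    simp
  · have : Finset.Ioc (n - 1) 0 = insert n (Finset.Ioc n 0) := by
      ext k
      simp only [Finset.mem_Ioc, Finset.mem_insert]
      omega
    rw [this, Finset.sum_insert (by simp), Finset.Ioc_eq_empty (by omega : ¬ 0 < n),
      Finset.Ioc_eq_empty (by omega : ¬ 0 < n - 1)]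
    simp

/-- The logarithmic derivative of `τ` along the `j`-th flow. -/
theorem exists_tau_logDer (j : ℕ) (L : PDO A) : ∃ φ : LatFun A,
    (∀ n m, φ (n + 1) m + φ n (m + 1) - (φ (n + 1) (m + 1) + φ n m) = Op.logDer j L n m) ∧
    ∀ n m, φ (n + 1) m + φ (n - 1) m - (φ n m + φ n m) =
      Op.subCoeff j L (n + 1) m - Op.subCoeff j L n m := by
  -- Each row m has its own constant of summation; it is harmless, since both identities involve φ
  -- only through differences in n.
  choose φ hφ using fun m => exists_sub_eq fun n => Op.subCoeff j L n m
  have h1 : ∀ n m, φ m (n + 1) - φ m n = Op.subCoeff j L (n + 1) m := by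
    intro n m
    simpa using hφ m (n + 1)
  refine ⟨fun n m => φ m n, fun n m => ?_, fun n m => ?_⟩
  · rw [Op.logDer, ← h1, ← h1]
    ring
  · rw [← h1, ← hφ]
    ring

end tau

/-! ### Points of the space and the velocities forced by the equations -/

namespace Op

variable {K : Type*} [CommRing K]

theorem opH_injective {u u' : LatFun K} (h : opH u = opH u') : u = u' := by
  funext n m
  have := congrFun (congrFun (congrFun (congrFun (congrArg val h) 0) 1) n) m
  rw [opH_eq_mono, opH_eq_mono] at this
  simpa [PDO.mono] using this

theorem eq_Lop {L : Op K} (hL : OrdLE 1 L) (hf : L ∈ freeRing K) :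
    L.val = Lop fun s => L.val (1 - s) 0 := by
  funext i j
  by_cases hj : j = 0
  · by_cases hi : i ≤ 1
    · simp [Lop, ofCoeffs, hj, hi]
    · simp [Lop, ofCoeffs, hj, hi, hL i 0 (by omega)]
  · simp [Lop, ofCoeffs, hj, hf i j hj]

theorem exists_op_Lop (v : ℕ → LatFun K) :
    ∃ L : Op K, L.val = Lop v ∧ OrdLE 1 L ∧ L ∈ freeRing K := by
  have h1 : ∀ i j, 1 < i → Lop v i j = 0 := by
    intro i j h
    simp [Lop, ofCoeffs, not_le.2 h]
  have h2 : ∀ i j, j ≠ 0 → Lop v i j = 0 := by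
    intro i j h
    simp [Lop, ofCoeffs, h]
  exact ⟨mk (Lop v) ⟨⟨1, h1⟩, 0, fun i j h => h2 i j (abs_pos.1 h)⟩, rfl, h1, h2⟩

/-- The conditions on `H` and `𝓛`, apart from the `τ`-ansatz. -/
structure IsPoint (u : LatFun K) (L e : Op K) : Prop where
  ord : OrdLE 1 L
  free : L ∈ freeRing K
  free_quotient : e ∈ freeRing K
  semiconj : opH u * L = e * opH u

/-- The ansatz makes u a unit, so the ideal condition becomes H 𝓛 = e H with e free of T₂, a form
stable under powers and derivations. -/
theorem mem_NVSpace_iff [Algebra ℂ K] {x : PDO K × PDO K} : x ∈ NVSpace K ↔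
    ∃ u L e, x = ((opH u).val, L.val) ∧ IsPoint u L e ∧ Ansatz u (L.val 1 0) := by
  constructor
  · rintro ⟨u, v, h1, h2, h3, h4⟩
    obtain ⟨L, hL, ho, hf⟩ := exists_op_Lop v
    rw [h1, h2, ← hL] at h3
    obtain ⟨e, he, hs⟩ := exists_free_quotient h4.isUnit hf h3
    refine ⟨u, L, e, Prod.ext (by rw [h1, val_opH]) (by rw [h2, hL]), ⟨ho, hf, he, hs⟩, ?_⟩
    have : L.val 1 0 = v 0 := by
      rw [hL]
      simp [Lop, ofCoeffs]
    rwa [this]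
  · rintro ⟨u, L, e, rfl, h, ha⟩
    refine ⟨u, fun s => L.val (1 - s) 0, val_opH u, eq_Lop h.ord h.free, ⟨(e - L).val,
      (e - L).isPlus, ?_⟩, by simpa using ha⟩
    show bracket _ _ = _
    rw [← val_bracket, ← val_mul, h.semiconj, sub_mul]

/-- The derivative of `H` along the `j`-th flow. -/
def fieldH (j : ℕ) (u : LatFun K) (L : Op K) : Op K :=
  -(fn (u * logDer j L.val) * (T₁ - T₂))

/-- The congruence for ∂H with its cofactor made explicit: ∂H = E H - H L_j. -/
theorem fieldH_eq {u : LatFun K} {L e : Op K} (h : IsPoint u L e) (j : ℕ) :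
    fieldH j u L = quotient u (laxSym j L) * opH u - opH u * lax j L := by
  rw [opH_mul_lax j h.ord h.free h.semiconj h.free_quotient, fieldH]
  abel

theorem satisfiesEq {u : LatFun K} {L e : Op K} (h : IsPoint u L e) (j : ℕ) :
    SatisfiesEq j ((opH u).val, L.val) ((fieldH j u L).val, (field j L).val) := by
  refine ⟨val_field j L, (quotient u (laxSym j L) - lax j L).val,
    isDiff_of_mem (sub_mem (quotient_mem_diffRing u (laxSym_mem_diffRing j L))
      (lax_mem_diffRing j L)), ?_⟩
  show _ - bracket (laxOp j L.val) (opH u).val = _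
  rw [← val_lax, ← val_bracket, ← val_sub, ← val_mul, fieldH_eq h]
  congr 1
  noncomm_ring

/-- The equations determine the derivatives of `H` and `𝓛`. -/
theorem eq_of_satisfiesEq {u w : LatFun K} {L e : Op K} (hu : ∀ n m, IsUnit (u n m))
    (h : IsPoint u L e) {j : ℕ} {D : PDO K}
    (hs : SatisfiesEq j ((opH u).val, L.val) ((-(fn w * (T₁ - T₂))).val, D)) :
    w = u * logDer j L.val ∧ D = (field j L).val := by
  obtain ⟨h1, E, hE, h2⟩ := hs
  refine ⟨?_, h1.trans (val_field j L).symm⟩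
  have h3 : -(fn w * (T₁ - T₂)) - (lax j L * opH u - opH u * lax j L) =
      mk E hE.1 * opH u := by
    ext1
    rw [val_sub, val_bracket, val_lax]
    exact h2
  have h4 := fieldH_eq h j
  have h5 : (quotient u (laxSym j L) - lax j L - mk E hE.1) * opH u =
      fn (w - u * logDer j L.val) * (T₁ - T₂) := by
    have h6 : fn (w - u * logDer j L.val) = fn w - fn (u * logDer j L.val) := by
      rw [eq_sub_iff_add_eq, fn, fn, ← mono_add, sub_add_cancel]
      rfl
    rw [sub_mul, sub_mul, ← h3, h6, eq_add_of_sub_eq h4.symm, fieldH]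
    noncomm_ring
  exact sub_eq_zero.1 (eq_zero_of_mul_opH hu h5)

/-- Insert ∂H = E H - H L_j and ∂𝓛 = [L_j, 𝓛]. The terms with L_j cancel through H 𝓛 = e H, and what
is left is a left multiple of H that measures the failure of ∂e = [E, e]. -/
theorem opMap_semiconj {A B : Type*} [CommRing A] [CommRing B] {ρ : A →+* B} {δ : A →+ B}
    (h : IsDer ρ δ) {u : LatFun A} {L e : Op A} {j : ℕ} {u₀ : LatFun B}
    (hu : ∀ n m, ρ (u n m) = u₀ n m)
    (hp : IsPoint u₀ (opHom ρ L) (opHom ρ e))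
    (hδu : ∀ n m, δ (u n m) = u₀ n m * logDer j (opHom ρ L).val n m)
    (hδL : opMap δ L = field j (opHom ρ L)) :
    opMap δ (opH u * L - e * opH u) =
      (quotient u₀ (laxSym j (opHom ρ L)) * opHom ρ e
        - opHom ρ e * quotient u₀ (laxSym j (opHom ρ L)) - opMap δ e) * opH u₀ := by
  have h1 : opHom ρ (opH u) = opH u₀ := by
    rw [opHom_opH]
    simp only [hu]
  have h2 : opMap δ (opH u) = fieldH j u₀ (opHom ρ L) := by
    rw [opMap_opH h]
    simp only [hδu]
    rfl
  rw [map_sub, opMap_mul h, opMap_mul h, h1, h2, hδL, fieldH_eq hp, field]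
  have hs := hp.semiconj
  set M := opHom ρ L
  set E := quotient u₀ (laxSym j M)
  set f := opHom ρ e
  set X := lax j M
  have e1 : opH u₀ * (X * M - M * X) + (E * opH u₀ - opH u₀ * X) * M -
      (f * (E * opH u₀ - opH u₀ * X) + opMap δ e * opH u₀) =
      E * (opH u₀ * M) - (opH u₀ * M) * X - f * E * opH u₀ + f * opH u₀ * X
        - opMap δ e * opH u₀ := by
    noncomm_ring
  rw [e1, hs]
  noncomm_ring

/-! ### Dual numbers -/

/-- The map `a + ε b ↦ a`. -/
def dualFst (K : Type*) [CommRing K] : DualNumber K →+* K :=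
  (TrivSqZeroExt.fstHom K K K : DualNumber K →+* K)

/-- The map `a + ε b ↦ b`. -/
def dualSnd (K : Type*) [CommRing K] : DualNumber K →+ K :=
  (TrivSqZeroExt.sndHom K K).toAddMonoidHom

theorem dualFst_apply (a : DualNumber K) : dualFst K a = TrivSqZeroExt.fst a := rfl
theorem dualSnd_apply (a : DualNumber K) : dualSnd K a = TrivSqZeroExt.snd a := rfl

theorem isDer_dual (K : Type*) [CommRing K] : IsDer (dualFst K) (dualSnd K) where
  leibniz a b := by
    simp [dualFst_apply, dualSnd_apply, mul_comm]

theorem dual_ext {x y : Op (DualNumber K)} (h : opHom (dualFst K) x = opHom (dualFst K) y)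
    (h' : opMap (dualSnd K) x = opMap (dualSnd K) y) : x = y := by
  refine ext (funext fun i => funext fun j => funext fun n => funext fun m =>
    TrivSqZeroExt.ext ?_ ?_)
  · exact congrFun (congrFun (congrFun (congrFun (congrArg val h) i) j) n) m
  · exact congrFun (congrFun (congrFun (congrFun (congrArg val h') i) j) n) m

/-- The operator `x + ε y`. -/
def eps (x y : Op K) : Op (DualNumber K) := mk (addEps x.val y.val) (by
  obtain ⟨N, M, hx, hy⟩ := bdd_common x.isPlus y.isPlus
  refine isPlus_iff.2 ⟨N, M, fun i j h => ?_, fun i j h => ?_⟩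
  · funext n m
    simp [addEps, hx.1 i j h, hy.1 i j h]
  · funext n m
    simp [addEps, hx.2 i j h, hy.2 i j h])

theorem val_eps (x y : Op K) : (eps x y).val = addEps x.val y.val := rfl

theorem fst_eps (x y : Op K) : opHom (dualFst K) (eps x y) = x := by
  ext i j n m
  simp [opHom_apply, val_eps, addEps, dualFst_apply]

theorem snd_eps (x y : Op K) : opMap (dualSnd K) (eps x y) = y := by
  ext i j n m
  simp [opMap_apply, val_eps, addEps, dualSnd_apply]

theorem eps_free {x y : Op K} (hx : x ∈ freeRing K) (hy : y ∈ freeRing K) :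
    eps x y ∈ freeRing (DualNumber K) := by
  intro i j h
  funext n m
  simp [val_eps, addEps, hx i j h, hy i j h]

theorem ordLE_eps {d : ℤ} {x y : Op K} (hx : OrdLE d x) (hy : OrdLE d y) : OrdLE d (eps x y) := by
  intro i j h
  funext n m
  simp [val_eps, addEps, hx i j h, hy i j h]

theorem isPoint_eps {u : LatFun K} {L e : Op K} (h : IsPoint u L e) (j : ℕ)
    {u' : LatFun (DualNumber K)} (hu : ∀ n m, dualFst K (u' n m) = u n m)
    (hu' : ∀ n m, dualSnd K (u' n m) = u n m * logDer j L.val n m) :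
    IsPoint u' (eps L (field j L)) (eps e (quotient u (laxSym j L) * e
      - e * quotient u (laxSym j L))) := by
  have hE := quotient_mem_freeRing u (laxSym_mem_freeRing j L)
  refine ⟨ordLE_eps h.ord (ordLE_field h.ord h.free j), eps_free h.free
    (field_mem_freeRing h.free j), eps_free h.free_quotient
    (sub_mem (mul_mem hE h.free_quotient) (mul_mem h.free_quotient hE)), ?_⟩
  refine dual_ext ?_ ?_
  · rw [map_mul, map_mul, fst_eps, fst_eps, opHom_opH]
    simp only [hu]
    exact h.semiconj
  · have := opMap_semiconj (isDer_dual K) (u := u') (L := eps L (field j L)) (j := j)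
      (e := eps e (quotient u (laxSym j L) * e - e * quotient u (laxSym j L))) hu
      (by rwa [fst_eps, fst_eps]) (by rwa [fst_eps]) (by rw [snd_eps, fst_eps])
    rw [map_sub, fst_eps, fst_eps, snd_eps, sub_self, zero_mul, sub_eq_zero] at this
    exact this

/-- Deform τ to τ (1 + ε φ) with the same C. The u' built from it has the required ε-part, and its
v₀ agrees with the leading coefficient of the deformed 𝓛. -/
theorem exists_ansatz_eps [Algebra ℂ K] {u : LatFun K} {L : Op K} (hL : OrdLE 1 L)
    (hf : L ∈ freeRing K) (h : Ansatz u (L.val 1 0)) (j : ℕ) :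
    ∃ u' : LatFun (DualNumber K), (∀ n m, dualFst K (u' n m) = u n m) ∧
      (∀ n m, dualSnd K (u' n m) = u n m * logDer j L.val n m) ∧
      Ansatz u' ((eps L (field j L)).val 1 0) := by
  obtain ⟨C, τ, hC, h1, h2⟩ := ansatz_iff.1 h
  obtain ⟨φ, p1, p2⟩ := exists_tau_logDer j L.val
  have hu : ∀ n m, IsUnit (TrivSqZeroExt.inl (τ n m : K) +
      TrivSqZeroExt.inr ((τ n m : K) * φ n m) : DualNumber K) := by
    intro n m
    rw [TrivSqZeroExt.isUnit_iff_isUnit_fst]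
    simp
  choose σ hσ using hu
  have f1 : (fun n m => Units.map (dualFst K : DualNumber K →* K) (σ n m)) = τ := by
    funext n m
    ext
    show dualFst K (σ n m) = _
    simp [hσ, dualFst_apply]
  have f2 : ∀ n m, HasLogDer (dualFst K) (dualSnd K) (σ n m) (φ n m) := by
    intro n m
    simp [HasLogDer, hσ, dualFst_apply, dualSnd_apply]
  have c1 : dualFst K (algebraMap ℂ (DualNumber K) C) = algebraMap ℂ K C := by
    simp [dualFst_apply, TrivSqZeroExt.algebraMap_eq_inl']
  have c2 : dualSnd K (algebraMap ℂ (DualNumber K) C) = 0 := by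
    simp [dualSnd_apply, TrivSqZeroExt.algebraMap_eq_inl']
  have k1 : ∀ n m, dualFst K (algebraMap ℂ (DualNumber K) C * (tauU σ n m : DualNumber K)) =
      u n m := by
    intro n m
    rw [map_mul, map_tauU, f1, c1, h1]
  refine ⟨fun n m => algebraMap ℂ (DualNumber K) C * (tauU σ n m : DualNumber K), k1, ?_,
    ansatz_iff.2 ⟨C, σ, hC, fun n m => rfl, fun n m => ?_⟩⟩
  · intro n m
    rw [(isDer_dual K).leibniz, c2, hasLogDer_tauU (isDer_dual K) f2, ← k1, p1, map_mul]
    ring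
  · refine TrivSqZeroExt.ext ?_ ?_
    · rw [← dualFst_apply, ← dualFst_apply, ← opHom_apply, fst_eps, map_tauV, f1, h2]
    · rw [← dualSnd_apply, ← dualSnd_apply, ← opMap_apply, snd_eps, hasLogDer_tauV (isDer_dual K) f2,
        p2, map_tauV, f1, ← h2, field_top hL hf]

theorem isField_field [Algebra ℂ K] {u : LatFun K} {L e : Op K} (h : IsPoint u L e)
    (ha : Ansatz u (L.val 1 0)) (j : ℕ) :
    IsField j ((opH u).val, L.val) ((fieldH j u L).val, (field j L).val) := by
  refine ⟨?_, satisfiesEq h j⟩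
  obtain ⟨u', h1, h2, h3⟩ := exists_ansatz_eps h.ord h.free ha j
  refine mem_NVSpace_iff.2 ⟨u', _, _, ?_, isPoint_eps h j h1 h2, h3⟩
  have : opH u' = eps (opH u) (fieldH j u L) := by
    refine dual_ext ?_ ?_
    · rw [fst_eps, opHom_opH]
      simp only [h1]
    · rw [snd_eps, opMap_opH (isDer_dual K)]
      simp only [h2]
      rfl
  rw [this]
  rfl

theorem addEps_inj {D E D' E' : PDO K} (h : addEps D E = addEps D' E') : D = D' ∧ E = E' := by
  constructor
  · funext i j n m
    have := congrArg TrivSqZeroExt.fst (congrFun (congrFun (congrFun (congrFun h i) j) n) m)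
    simpa [addEps] using this
  · funext i j n m
    have := congrArg TrivSqZeroExt.snd (congrFun (congrFun (congrFun (congrFun h i) j) n) m)
    simpa [addEps] using this

theorem addEps_map (D : PDO (DualNumber K)) :
    addEps (PDO.map (dualFst K) D) (PDO.map (dualSnd K) D) = D := by
  funext i j n m
  exact TrivSqZeroExt.inl_fst_add_inr_snd_eq _

theorem isField_unique [Algebra ℂ K] {u : LatFun K} {L e : Op K} (h : IsPoint u L e)
    (ha : Ansatz u (L.val 1 0)) {j : ℕ} {ξ : PDO K × PDO K}
    (hξ : IsField j ((opH u).val, L.val) ξ) :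
    ξ = ((fieldH j u L).val, (field j L).val) := by
  obtain ⟨ht, hs⟩ := hξ
  obtain ⟨u', L', e', h1, -, -⟩ := mem_NVSpace_iff.1 ht
  have h2 : addEps (opH u).val ξ.1 = (opH u').val := congrArg Prod.fst h1
  rw [← addEps_map (opH u').val] at h2
  have h3 := (addEps_inj h2).2
  -- Tangency is used here only through the shape of H, which makes the first component of ξ equal
  -- to -w (T₁ - T₂).
  rw [← val_opMap, opMap_opH (isDer_dual K)] at h3
  obtain ⟨ξ₁, ξ₂⟩ := ξ
  subst h3
  obtain ⟨h4, h5⟩ := eq_of_satisfiesEq ha.isUnit h hs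
  rw [h5, h4]
  rfl

theorem pointEps_field [Algebra ℂ K] {u : LatFun K} {L : Op K} {j : ℕ}
    (h : IsTangent ((opH u).val, L.val) ((fieldH j u L).val, (field j L).val)) :
    ∃ u' L' e', pointEps ((opH u).val, L.val) ((fieldH j u L).val, (field j L).val) =
      ((opH u').val, L'.val) ∧ IsPoint u' L' e' ∧ Ansatz u' (L'.val 1 0) ∧
      opHom (dualFst K) L' = L ∧ opMap (dualSnd K) L' = field j L ∧
      (∀ n m, dualFst K (u' n m) = u n m) ∧
      ∀ n m, dualSnd K (u' n m) = u n m * logDer j L.val n m := by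
  obtain ⟨u', L', e', h1, hp, ha⟩ := mem_NVSpace_iff.1 h
  have h2 : eps L (field j L) = L' := ext (congrArg Prod.snd h1)
  have h3 : eps (opH u) (fieldH j u L) = opH u' := ext (congrArg Prod.fst h1)
  have h4 := congrArg (opHom (dualFst K)) h3
  have h5 := congrArg (opMap (dualSnd K)) h3
  rw [fst_eps, opHom_opH] at h4
  rw [snd_eps, opMap_opH (isDer_dual K), fieldH, neg_inj] at h5
  have h6 := opH_injective h4
  refine ⟨u', L', e', h1, hp, ha, h2 ▸ fst_eps _ _, h2 ▸ snd_eps _ _, fun n m => ?_, fun n m => ?_⟩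
  · rw [h6]
  · have := congrFun (congrFun (congrFun (congrFun (congrArg val h5) 1) 0) n) m
    rw [mul_T₁_sub_T₂_apply, mul_T₁_sub_T₂_apply] at this
    simpa [fn, PDO.mono] using this.symm

end Op
end
end DiscreteNV

namespace DiscreteNV

noncomputable section

open PDO Op

/-! ### The vector fields -/

variable {K : Type*} [CommRing K] [Algebra ℂ K]

theorem existsUnique_isField {x : PDO K × PDO K} (hx : x ∈ NVSpace K) (j : ℕ) :
    ∃! ξ : PDO K × PDO K, IsField j x ξ := by
  obtain ⟨u, L, e, rfl, h, ha⟩ := mem_NVSpace_iff.1 hx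
  exact ⟨_, isField_field h ha j, fun ξ hξ => isField_unique h ha hξ⟩

theorem isField_comm {x : PDO K × PDO K} (hx : x ∈ NVSpace K) {i j : ℕ}
    {ξ η : PDO K × PDO K} (hξ : IsField i x ξ) (hη : IsField j x η)
    {ξ' η' : PDO (DualNumber K) × PDO (DualNumber K)} (hξ' : IsField i (pointEps x η) ξ')
    (hη' : IsField j (pointEps x ξ) η') :
    epsPart ξ'.1 = epsPart η'.1 ∧ epsPart ξ'.2 = epsPart η'.2 := by
  obtain ⟨u, L, e, rfl, h, ha⟩ := mem_NVSpace_iff.1 hx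
  obtain rfl := isField_unique h ha hξ
  obtain rfl := isField_unique h ha hη
  obtain ⟨u₁, L₁, e₁, q₁, h₁, ha₁, a₁, b₁, c₁, d₁⟩ := pointEps_field hη.1
  obtain ⟨u₂, L₂, e₂, q₂, h₂, ha₂, a₂, b₂, c₂, d₂⟩ := pointEps_field hξ.1
  rw [q₁] at hξ'
  rw [q₂] at hη'
  obtain rfl := isField_unique h₁ ha₁ hξ'
  obtain rfl := isField_unique h₂ ha₂ hη'
  have hD := isDer_dual K
  constructor
  · show (opMap (dualSnd K) (fieldH i u₁ L₁)).val = (opMap (dualSnd K) (fieldH j u₂ L₂)).val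
    have key : ∀ n m, dualSnd K ((u₁ * logDer i L₁.val) n m) =
        dualSnd K ((u₂ * logDer j L₂.val) n m) := by
      intro n m
      -- The points L₁ and L₂ over K[ε] differ, but both reduce to L; L₁ is moved along the j-th
      -- field and L₂ along the i-th.
      have := logDer_comm (i := j) (j := i) hD hD h₁.ord h₁.free h₂.ord h₂.free (by rw [a₁, a₂])
        (by rw [b₁, a₁]) (by rw [b₂, a₁]) n m
      have l₁ := logDer_opHom (dualFst K) h₁.ord h₁.free i n m
      have l₂ := logDer_opHom (dualFst K) h₂.ord h₂.free j n m
      rw [a₁] at l₁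
      rw [a₂] at l₂
      simp only [Pi.mul_apply]
      rw [hD.leibniz, hD.leibniz, c₁, c₂, d₁, d₂, this, ← l₁, ← l₂]
      ring
    have hT : ∀ w : LatFun (DualNumber K), opMap (dualSnd K) (-(fn w * (T₁ - T₂))) =
        -(fn (fun n m => dualSnd K (w n m)) * (T₁ - T₂)) := by
      intro w
      have h1 : opHom (dualFst K) (T₁ - T₂ : Op (DualNumber K)) = T₁ - T₂ := by
        rw [map_sub, T₁, T₂, opHom_mono_one, opHom_mono_one]
        rfl
      have h2 : opMap (dualSnd K) (T₁ - T₂ : Op (DualNumber K)) = 0 := by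
        rw [map_sub, T₁, T₂, opMap_mono_one hD, opMap_mono_one hD, sub_zero]
      rw [map_neg, opMap_mul hD, h1, h2, mul_zero, zero_add, fn, opMap_mono]
      rfl
    rw [fieldH, fieldH, hT, hT]
    simp only [key]
  · exact congrArg val (opMap_field_comm (i := j) (j := i) hD hD h₁.ord h₁.free h₂.ord h₂.free
      (by rw [a₁, a₂]) (by rw [b₁, a₁]) (by rw [b₂, a₁]))

end
end DiscreteNV

namespace DiscreteNV

noncomputable section

open PDO Op

/-! ### Ordinary differential equations for formal power series -/

section formal

open PowerSeries

variable {K : Type*} [CommRing K]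

/-- The derivation `d/dt` of `K⟦t⟧`. -/
def ddt (K : Type*) [CommRing K] : PowerSeries K →+ PowerSeries K :=
  (PowerSeries.derivative K).toLinearMap.toAddMonoidHom

theorem ddt_apply (f : PowerSeries K) : ddt K f = PowerSeries.derivative K f := rfl

theorem coeff_ddt (f : PowerSeries K) (n : ℕ) :
    coeff n (ddt K f) = coeff (n + 1) f * (n + 1) := coeff_derivative f n

theorem isDer_ddt (K : Type*) [CommRing K] : IsDer (RingHom.id (PowerSeries K)) (ddt K) where
  leibniz a b := by
    rw [ddt_apply, Derivation.leibniz]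
    simp [ddt_apply, mul_comm]

theorem X_pow_dvd_ddt {f : PowerSeries K} {k : ℕ} (h : X ^ (k + 1) ∣ f) :
    X ^ k ∣ ddt K f := by
  rw [X_pow_dvd_iff] at *
  intro n hn
  rw [coeff_ddt, h _ (by omega), zero_mul]

variable [Algebra ℂ K]

theorem natCast_succ_mul (n : ℕ) : algebraMap ℂ K ((n : ℂ) + 1)⁻¹ * ((n : K) + 1) = 1 := by
  have h : ((n : K) + 1) = algebraMap ℂ K ((n : ℂ) + 1) := by simp
  rw [h, ← map_mul, inv_mul_cancel₀ (by exact_mod_cast n.succ_ne_zero), map_one]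

/-- The power series `∫₀^t f`. -/
def integral (f : PowerSeries K) : PowerSeries K :=
  -- At n = 0 the convention 0⁻¹ = 0 gives constant term 0, whatever the truncated index n - 1
  -- picks.
  PowerSeries.mk fun n => algebraMap ℂ K (n : ℂ)⁻¹ * coeff (n - 1) f

theorem ddt_integral (f : PowerSeries K) : ddt K (integral f) = f := by
  ext n
  rw [coeff_ddt, integral, coeff_mk, Nat.add_sub_cancel]
  push_cast
  linear_combination (coeff n f) * natCast_succ_mul (K := K) n

theorem X_pow_dvd_of_ddt {f : PowerSeries K} (h0 : constantCoeff f = 0) {k : ℕ}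
    (h : X ^ k ∣ ddt K f) : X ^ (k + 1) ∣ f := by
  rw [X_pow_dvd_iff] at *
  intro n hn
  rcases n with _ | n
  · simpa using h0
  · have := h n (by omega)
    rw [coeff_ddt] at this
    linear_combination (-coeff (n + 1) f) * natCast_succ_mul (K := K) n +
      algebraMap ℂ K ((n : ℂ) + 1)⁻¹ * this

theorem constantCoeff_integral (f : PowerSeries K) : constantCoeff (integral f) = 0 := by
  rw [← coeff_zero_eq_constantCoeff_apply, integral, coeff_mk]
  simp

/-- A t-adic Gronwall argument: integration gains one power of t at each step. The family is treated
jointly and may be infinite. -/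
theorem formal_eq_zero {ι : Type*} {f : ι → PowerSeries K} (h0 : ∀ i, constantCoeff (f i) = 0)
    (h : ∀ k : ℕ, (∀ i, X ^ k ∣ f i) → ∀ i, X ^ k ∣ ddt K (f i)) (i : ι) : f i = 0 := by
  have key : ∀ k : ℕ, ∀ i, X ^ k ∣ f i := by
    intro k
    induction k with
    | zero => simp
    | succ k ih => exact fun i => X_pow_dvd_of_ddt (h0 i) (h k ih i)
  ext n
  exact X_pow_dvd_iff.1 (key (n + 1) i) n (by omega)

/-- Picard iteration converges t-adically as soon as F respects congruence modulo each t^k; the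
number of unknowns does not matter. -/
theorem exists_formal_solution {ι : Type*} (F : (ι → PowerSeries K) → ι → PowerSeries K)
    (hF : ∀ (k : ℕ) x y, (∀ i, X ^ k ∣ x i - y i) → ∀ i, X ^ k ∣ F x i - F y i) (x₀ : ι → K) :
    ∃ x : ι → PowerSeries K, (∀ i, constantCoeff (x i) = x₀ i) ∧ ∀ i, ddt K (x i) = F x i := by
  obtain ⟨a, a_zero, a_succ⟩ : ∃ a : ℕ → ι → PowerSeries K, (∀ i, a 0 i = C (x₀ i)) ∧
      ∀ k i, a (k + 1) i = C (x₀ i) + integral (F (a k) i) :=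
    ⟨fun k => Nat.rec (fun i => C (x₀ i)) (fun _ y i => C (x₀ i) + integral (F y i)) k,
      fun _ => rfl, fun _ _ => rfl⟩
  have a_const : ∀ k i, constantCoeff (a k i) = x₀ i := by
    intro k i
    cases k with
    | zero => rw [a_zero, constantCoeff_C]
    | succ k => rw [a_succ, map_add, constantCoeff_integral, constantCoeff_C, add_zero]
  have a_ddt : ∀ k i, ddt K (a (k + 1) i) = F (a k) i := by
    intro k i
    rw [a_succ, map_add, ddt_integral, ddt_apply, derivative_C, zero_add]
  have step : ∀ k : ℕ, ∀ i, X ^ (k + 1) ∣ a (k + 1) i - a k i := by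
    intro k
    induction k with
    | zero =>
      intro i
      refine X_pow_dvd_of_ddt ?_ (by simp)
      rw [map_sub, a_const, a_const, sub_self]
    | succ k ih =>
      intro i
      refine X_pow_dvd_of_ddt ?_ ?_
      · rw [map_sub, a_const, a_const, sub_self]
      · rw [map_sub, a_ddt, a_ddt]
        exact hF _ _ _ ih i
  have stable : ∀ k l : ℕ, ∀ i, X ^ (k + 1) ∣ a (k + l) i - a k i := by
    intro k l
    induction l with
    | zero => simp
    | succ l ih =>
      intro i
      have h1 : X ^ (k + 1) ∣ a (k + l + 1) i - a (k + l) i :=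
        (pow_dvd_pow _ (by omega)).trans (step (k + l) i)
      have := dvd_add h1 (ih i)
      rwa [sub_add_sub_cancel] at this
  -- The diagonal limit: the coefficient of t^n no longer changes from the n-th iterate on.
  let x : ι → PowerSeries K := fun i => PowerSeries.mk fun n => coeff n (a n i)
  have hx : ∀ k i, X ^ (k + 1) ∣ x i - a k i := by
    intro k i
    rw [X_pow_dvd_iff]
    intro n hn
    have := X_pow_dvd_iff.1 (stable n (k - n) i) n (by omega)
    rw [show n + (k - n) = k by omega, map_sub] at this
    rw [map_sub, coeff_mk, ← neg_sub, this, neg_zero]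
  refine ⟨x, fun i => ?_, fun i => ?_⟩
  · rw [← coeff_zero_eq_constantCoeff_apply, coeff_mk, coeff_zero_eq_constantCoeff_apply, a_const]
  · have key : ∀ k : ℕ, X ^ k ∣ ddt K (x i) - F x i := by
      intro k
      have h1 := X_pow_dvd_ddt (hx k i)
      have h2 := X_pow_dvd_ddt ((pow_dvd_pow _ (by omega)).trans (hx (k + 1) i) :
        X ^ (k + 1) ∣ x i - a (k + 1) i)
      rw [map_sub, a_ddt] at h2
      have h3 := hF k x (a k) (fun i => (pow_dvd_pow _ (by omega)).trans (hx k i)) i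
      have := dvd_sub h2 h3
      rwa [sub_sub_sub_cancel_right] at this
    rw [← sub_eq_zero]
    ext n
    exact X_pow_dvd_iff.1 (key (n + 1)) n (by omega)

theorem formal_linear_unique {ψ x y : PowerSeries K} (h0 : constantCoeff x = constantCoeff y)
    (hx : ddt K x = x * ψ) (hy : ddt K y = y * ψ) : x = y := by
  rw [← sub_eq_zero]
  refine formal_eq_zero (ι := Unit) (f := fun _ => x - y) (fun _ => ?_) (fun k h i => ?_) ()
  · rw [map_sub, h0, sub_self]
  · rw [map_sub, hx, hy, ← sub_mul]
    exact (h i).mul_right _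

theorem exists_formal_linear (ψ : PowerSeries K) (x₀ : K) :
    ∃ x : PowerSeries K, constantCoeff x = x₀ ∧ ddt K x = x * ψ := by
  obtain ⟨x, h1, h2⟩ := exists_formal_solution (ι := Unit) (fun x i => x i * ψ)
    (fun k x y h i => by rw [← sub_mul]; exact (h i).mul_right _) (fun _ => x₀)
  exact ⟨x (), h1 (), h2 ()⟩

end formal

namespace Op

variable {A : Type*} [CommRing A]

/-! ### The inverse of the leading coefficient of `H` -/

/-- The inverse of `T₁ + u`. -/
def leadInv (u : LatFun A) : Op A := mk (ofCoeffs fun i n m =>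
    -- The geometric series ∑ (-T₁⁻¹ u)^k T₁⁻¹, whose k-th term sits at i = -1 - k.
    if i ≤ -1 then ∏ l ∈ Finset.range (-1 - i).toNat, -u (n - 1 - l) m else 0) (by
  refine isPlus_iff.2 ⟨-1, 0, fun i j h => ?_, fun i j h => ?_⟩
  · have : ¬ i ≤ -1 := by omega
    funext n m
    by_cases hj : j = 0 <;> simp [ofCoeffs, this, hj]
  · have : j ≠ 0 := abs_pos.1 h
    simp [ofCoeffs, this])

theorem leadInv_mem_freeRing (u : LatFun A) : leadInv u ∈ freeRing A := by
  intro i j h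
  simp [leadInv, ofCoeffs, h]

theorem leadInv_apply (u : LatFun A) (i n m : ℤ) : (leadInv u).val i 0 n m =
    if i ≤ -1 then ∏ l ∈ Finset.range (-1 - i).toNat, -u (n - 1 - l) m else 0 := by
  simp [leadInv, ofCoeffs]

theorem leadInv_mul_lead (u : LatFun A) : leadInv u * lead u = 1 := by
  refine free_ext (mul_mem (leadInv_mem_freeRing u) (lead_mem_freeRing u)) (one_mem _) fun i => ?_
  funext n m
  have e : (leadInv u * lead u).val i 0 n m =
      (leadInv u).val (i - 1) 0 n m + (leadInv u).val i 0 n m * u (n + i) m := by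
    simp [lead, mul_add, T₁, fn, mul_mono_apply]
  rw [e, leadInv_apply, leadInv_apply]
  rcases lt_trichotomy i 0 with h | h | h
  · have h1 : (-1 - (i - 1)).toNat = (-1 - i).toNat + 1 := by omega
    have h2 : n - 1 - ((-1 - i).toNat : ℤ) = n + i := by omega
    rw [if_pos (by omega), if_pos (by omega), h1, Finset.prod_range_succ, h2]
    simp [PDO.mono, h.ne]
  · simp [h, PDO.mono]
  · rw [if_neg (by omega), if_neg (by omega)]
    simp [PDO.mono, h.ne']

theorem lead_mul_leadInv (u : LatFun A) : lead u * leadInv u = 1 := by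
  refine free_ext (mul_mem (lead_mem_freeRing u) (leadInv_mem_freeRing u)) (one_mem _) fun i => ?_
  funext n m
  have e : (lead u * leadInv u).val i 0 n m =
      (leadInv u).val (i - 1) 0 (n + 1) m + u n m * (leadInv u).val i 0 n m := by
    simp [lead, add_mul, T₁, fn, mono_mul_apply]
  rw [e, leadInv_apply, leadInv_apply]
  rcases lt_trichotomy i 0 with h | h | h
  · have h1 : (-1 - (i - 1)).toNat = (-1 - i).toNat + 1 := by omega
    have h2 : ∀ l : ℕ, n + 1 - 1 - ((l + 1 : ℕ) : ℤ) = n - 1 - l := fun l => by push_cast; ring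
    rw [if_pos (by omega), if_pos (by omega), h1, Finset.prod_range_succ']
    simp only [h2]
    simp [PDO.mono, h.ne, mul_comm]
  · simp [h, PDO.mono]
  · rw [if_neg (by omega), if_neg (by omega)]
    simp [PDO.mono, h.ne']

/-- The quotient of `H 𝓛` by `H`, if there is one. -/
def quot (u : LatFun A) (L : Op A) : Op A := lead u * (T₂ * L * T₂i) * leadInv u

theorem quot_mem_freeRing (u : LatFun A) {L : Op A} (hf : L ∈ freeRing A) :
    quot u L ∈ freeRing A :=
  mul_mem (mul_mem (lead_mem_freeRing u) (free_conj hf)) (leadInv_mem_freeRing u)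

/-- `quot` is chosen to cancel the terms with T₂, so for L free of T₂ the defect is free of T₂ as
well, whether or not it vanishes. -/
theorem opH_mul_sub_quot (u : LatFun A) (L : Op A) :
    opH u * L - quot u L * opH u = quot u L * rest u - rest u * L := by
  have h : quot u L * lead u * T₂ = lead u * T₂ * L := by
    have : quot u L * lead u * T₂ =
        lead u * T₂ * L * T₂i * (leadInv u * lead u) * T₂ := by
      simp only [quot, mul_assoc]
    rw [this, leadInv_mul_lead, mul_one, mul_assoc, T₂i_mul_T₂, mul_one]
  rw [opH_eq, sub_mul, mul_sub, ← mul_assoc, h]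
  abel

theorem eq_zero_of_mul_T₂ {x y : Op A} (hx : x ∈ freeRing A) (hy : y ∈ freeRing A)
    (h : x * T₂ = y) : x = 0 := by
  refine free_ext hx (zero_mem _) fun i => ?_
  funext n m
  have := congrFun (congrFun (congrFun (congrFun (congrArg val h) i) 1) n) m
  rw [hy i 1 one_ne_zero] at this
  simpa [T₂, mul_mono_apply] using this

/-- The T₂-part of x H is x (T₁ + u) T₂, and T₁ + u is invertible for every u. -/
theorem eq_zero_of_mul_opH_free {u : LatFun A} {x : Op A} (hx : x ∈ freeRing A)
    (h : x * opH u ∈ freeRing A) : x = 0 := by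
  have h1 : x * lead u * T₂ = x * opH u + x * rest u := by
    rw [opH_eq, mul_sub, mul_assoc, sub_add_cancel]
  have h2 := eq_zero_of_mul_T₂ (mul_mem hx (lead_mem_freeRing u))
    (add_mem h (mul_mem hx (rest_mem_freeRing u))) h1
  have h3 : x = x * lead u * leadInv u := by rw [mul_assoc, lead_mul_leadInv, mul_one]
  rw [h3, h2, zero_mul]

theorem eq_quot {u : LatFun A} {L e : Op A} (hf : L ∈ freeRing A) (he : e ∈ freeRing A)
    (h : opH u * L = e * opH u) : e = quot u L := by
  rw [← sub_eq_zero]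
  refine eq_zero_of_mul_opH_free (u := u) (sub_mem he (quot_mem_freeRing u hf)) ?_
  rw [sub_mul, ← h, opH_mul_sub_quot]
  exact sub_mem (mul_mem (quot_mem_freeRing u hf) (rest_mem_freeRing u))
    (mul_mem (rest_mem_freeRing u) hf)

theorem isPoint_iff {u : LatFun A} {L : Op A} (hL : OrdLE 1 L) (hf : L ∈ freeRing A) :
    IsPoint u L (quot u L) ↔ opH u * L - quot u L * opH u = 0 :=
  ⟨fun h => sub_eq_zero.2 h.semiconj,
    fun h => ⟨hL, hf, quot_mem_freeRing u hf, sub_eq_zero.1 h⟩⟩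

theorem opHom_lead {B : Type*} [CommRing B] (ρ : A →+* B) (u : LatFun A) :
    opHom ρ (lead u) = lead fun n m => ρ (u n m) := by
  rw [lead, map_add, T₁, opHom_mono_one, fn, opHom_mono]
  rfl

theorem opHom_quot {B : Type*} [CommRing B] (ρ : A →+* B) (u : LatFun A) (L : Op A) :
    opHom ρ (quot u L) = quot (fun n m => ρ (u n m)) (opHom ρ L) := by
  have h : opHom ρ (leadInv u) = leadInv fun n m => ρ (u n m) := by
    have h1 : opHom ρ (leadInv u) * lead (fun n m => ρ (u n m)) = 1 := by
      rw [← opHom_lead, ← map_mul, leadInv_mul_lead, map_one]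
    exact left_inv_eq_right_inv h1 (lead_mul_leadInv _)
  simp only [quot, map_mul, h, opHom_lead, T₂, T₂i, opHom_mono_one]

end Op

end
end DiscreteNV

namespace DiscreteNV

noncomputable section

open PDO Op

theorem IsDer.comp {A B C : Type*} [CommRing A] [CommRing B] [CommRing C] {ρ : A →+* B}
    {δ : A →+ B} (h : IsDer ρ δ) (π : B →+* C) : IsDer (π.comp ρ) ((π : B →+ C).comp δ) where
  leibniz a b := by
    simp [h.leibniz]

/-! ### Reduction modulo t^k and formal trajectories -/

namespace Op

open PowerSeries

variable {K : Type*} [CommRing K]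

/-- Reduction modulo `t^k`. -/
def modX (K : Type*) [CommRing K] (k : ℕ) :
    PowerSeries K →+* PowerSeries K ⧸ Ideal.span {(X : PowerSeries K) ^ k} :=
  Ideal.Quotient.mk _

theorem modX_eq_zero {k : ℕ} {f : PowerSeries K} : modX K k f = 0 ↔ X ^ k ∣ f := by
  rw [modX, Ideal.Quotient.eq_zero_iff_mem, Ideal.mem_span_singleton]

theorem modX_eq {k : ℕ} {f g : PowerSeries K} : modX K k f = modX K k g ↔ X ^ k ∣ f - g := by
  rw [← modX_eq_zero, map_sub, sub_eq_zero]

/-- The derivation `d/dt` followed by the reduction modulo `t^k`. -/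
def ddtMod (K : Type*) [CommRing K] (k : ℕ) :
    PowerSeries K →+ PowerSeries K ⧸ Ideal.span {(X : PowerSeries K) ^ k} :=
  (modX K k : PowerSeries K →+ _).comp (ddt K)

theorem isDer_ddtMod (k : ℕ) : IsDer (modX K k) (ddtMod K k) := (isDer_ddt K).comp (modX K k)

theorem opMap_ddtMod (k : ℕ) (x : Op (PowerSeries K)) :
    opMap (ddtMod K k) x = opHom (modX K k) (opMap (ddt K) x) := rfl

variable [Algebra ℂ K]

theorem formal_op_eq_zero {Z : Op (PowerSeries K)} (h0 : opHom (constantCoeff (R := K)) Z = 0)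
    (h : ∀ k, opHom (modX K k) Z = 0 → opMap (ddtMod K k) Z = 0) : Z = 0 := by
  ext i j n m : 5
  refine formal_eq_zero (ι := ℤ × ℤ × ℤ × ℤ) (f := fun p => Z.val p.1 p.2.1 p.2.2.1 p.2.2.2)
    (fun p => ?_) (fun k hk p => ?_) (i, j, n, m)
  · rw [← opHom_apply, h0]
    rfl
  · have : opHom (modX K k) Z = 0 := by
      ext i j n m
      rw [opHom_apply]
      exact modX_eq_zero.2 (hk (i, j, n, m))
    have := congrFun (congrFun (congrFun (congrFun (congrArg val (h k this)) p.1) p.2.1) p.2.2.1)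
      p.2.2.2
    exact modX_eq_zero.1 this

theorem ext_of_ordLE_one {B : Type*} [CommRing B] {x y : Op B} (h1 : OrdLE 1 x) (h2 : OrdLE 1 y)
    (h3 : x ∈ freeRing B) (h4 : y ∈ freeRing B)
    (h5 : ∀ (s : ℕ) n m, x.val (1 - (s : ℤ)) 0 n m = y.val (1 - (s : ℤ)) 0 n m) : x = y := by
  refine free_ext h3 h4 fun i => ?_
  by_cases hi : i ≤ 1
  · funext n m
    have := h5 (1 - i).toNat n m
    rwa [show 1 - ((1 - i).toNat : ℤ) = i by omega] at this
  · rw [h1 i 0 (by omega), h2 i 0 (by omega)]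

/-- A formal solution of the evolution equation for `𝓛`. -/
theorem exists_formal_field {L₀ : Op K} (hL : OrdLE 1 L₀) (hf : L₀ ∈ freeRing K) (j : ℕ) :
    ∃ L : Op (PowerSeries K), OrdLE 1 L ∧ L ∈ freeRing (PowerSeries K) ∧
      opHom (constantCoeff (R := K)) L = L₀ ∧ opMap (ddt K) L = field j L := by
  choose T hT hTo hTf using exists_op_Lop (K := PowerSeries K)
  let F : (ℕ × ℤ × ℤ → PowerSeries K) → Op (PowerSeries K) := fun x =>
    T fun s n m => x (s, n, m)
  have hF : ∀ x (s : ℕ) n m, (F x).val (1 - (s : ℤ)) 0 n m = x (s, n, m) := by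
    intro x s n m
    simp [F, hT, Lop, ofCoeffs]
  obtain ⟨x, h1, h2⟩ := exists_formal_solution
    (fun x (p : ℕ × ℤ × ℤ) => (field j (F x)).val (1 - (p.1 : ℤ)) 0 p.2.1 p.2.2)
    (fun k x y hxy p => by
      -- Reduction modulo t^k is a ring homomorphism and the field commutes with it; this is the
      -- compatibility that Picard iteration needs.
      have e : opHom (modX K k) (F x) = opHom (modX K k) (F y) := by
        refine ext_of_ordLE_one ((hTo _).opHom _) ((hTo _).opHom _) (opHom_free (hTf _))
          (opHom_free (hTf _)) fun s n m => ?_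
        rw [opHom_apply, opHom_apply, hF, hF]
        exact modX_eq.2 (hxy (s, n, m))
      have e' : opHom (modX K k) (field j (F x)) = opHom (modX K k) (field j (F y)) := by
        rw [opHom_field _ (hTo _) (hTf _), opHom_field _ (hTo _) (hTf _), e]
      exact modX_eq.1 (congrFun (congrFun (congrFun (congrFun (congrArg val e') _) _) _) _))
    (fun p => L₀.val (1 - (p.1 : ℤ)) 0 p.2.1 p.2.2)
  have hxo : OrdLE 1 (F x) := hTo _
  have hxf : F x ∈ freeRing (PowerSeries K) := hTf _
  refine ⟨F x, hxo, hxf, ?_, ?_⟩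
  · refine ext_of_ordLE_one (hxo.opHom _) hL (opHom_free hxf) hf fun s n m => ?_
    rw [opHom_apply, hF, h1]
  · refine ext_of_ordLE_one (hxo.opMap _) (ordLE_field hxo hxf j) (opMap_free hxf)
      (field_mem_freeRing hxf j) fun s n m => ?_
    rw [opMap_apply, hF, h2]

/-- The evolution equations in terms of `u` and `𝓛`. -/
structure IsFlow (j : ℕ) (u₀ : LatFun K) (L₀ : Op K) (u : LatFun (PowerSeries K))
    (L : Op (PowerSeries K)) : Prop where
  ord : OrdLE 1 L
  free : L ∈ freeRing (PowerSeries K)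
  init_u : ∀ n m, constantCoeff (u n m) = u₀ n m
  init_L : opHom (constantCoeff (R := K)) L = L₀
  eq_u : ∀ n m, ddt K (u n m) = u n m * logDer j L.val n m
  eq_L : opMap (ddt K) L = field j L

theorem IsFlow.unique {j : ℕ} {u₀ : LatFun K} {L₀ : Op K} {u u' : LatFun (PowerSeries K)}
    {L L' : Op (PowerSeries K)} (h : IsFlow j u₀ L₀ u L) (h' : IsFlow j u₀ L₀ u' L') :
    u = u' ∧ L = L' := by
  have hL : L = L' := by
    rw [← sub_eq_zero]
    refine formal_op_eq_zero ?_ fun k hk => ?_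
    · rw [map_sub, h.init_L, h'.init_L, sub_self]
    · rw [map_sub, sub_eq_zero] at hk
      rw [opMap_ddtMod, map_sub, map_sub, h.eq_L, h'.eq_L, opHom_field _ h.ord h.free,
        opHom_field _ h'.ord h'.free, hk, sub_self]
  refine ⟨?_, hL⟩
  subst hL
  funext n m
  exact formal_linear_unique (by rw [h.init_u, h'.init_u]) (h.eq_u n m) (h'.eq_u n m)

/-- Let Z be the defect of H 𝓛 = e H with e = `quot u L`. If Z vanishes modulo t^k, its derivative
modulo t^k is a T₂-free multiple Y H. It is also free of T₂, so Y = 0 and one more power of t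
divides Z. -/
theorem IsFlow.isPoint {j : ℕ} {u₀ : LatFun K} {L₀ e₀ : Op K} {u : LatFun (PowerSeries K)}
    {L : Op (PowerSeries K)} (h : IsFlow j u₀ L₀ u L) (h₀ : IsPoint u₀ L₀ e₀) :
    IsPoint u L (quot u L) := by
  have hu : (fun n m => constantCoeff (u n m)) = u₀ := funext fun n => funext fun m => h.init_u n m
  refine (isPoint_iff h.ord h.free).2 (formal_op_eq_zero ?_ fun k hk => ?_)
  · rw [map_sub, map_mul, map_mul, opHom_opH, opHom_quot, hu, h.init_L,
      ← eq_quot h₀.free h₀.free_quotient h₀.semiconj, h₀.semiconj, sub_self]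
  · have hq : opHom (modX K k) (quot u L) = quot (fun n m => modX K k (u n m))
        (opHom (modX K k) L) := opHom_quot _ _ _
    have hp : IsPoint (fun n m => modX K k (u n m)) (opHom (modX K k) L)
        (opHom (modX K k) (quot u L)) := by
      rw [map_sub, map_mul, map_mul, opHom_opH, hq] at hk
      rw [hq]
      exact (isPoint_iff (h.ord.opHom _) (opHom_free h.free)).2 hk
    have key := opMap_semiconj (isDer_ddtMod k) (u := u) (L := L) (e := quot u L) (j := j)
      (fun n m => rfl) hp (fun n m => by
        rw [logDer_opHom _ h.ord h.free, ← map_mul, ← h.eq_u]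
        rfl) (by rw [opMap_ddtMod, h.eq_L, opHom_field _ h.ord h.free])
    have hE := quotient_mem_freeRing (fun n m => modX K k (u n m))
      (laxSym_mem_freeRing j (opHom (modX K k) L))
    have hY := sub_mem (sub_mem (mul_mem hE hp.free_quotient) (mul_mem hp.free_quotient hE))
      (opMap_free (f := ddtMod K k) (quot_mem_freeRing u h.free))
    have hZ : opMap (ddtMod K k) (opH u * L - quot u L * opH u) ∈ freeRing _ := by
      rw [opH_mul_sub_quot]
      exact opMap_free (sub_mem (mul_mem (quot_mem_freeRing u h.free) (rest_mem_freeRing u))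
        (mul_mem (rest_mem_freeRing u) h.free))
    rw [key] at hZ
    rw [key, eq_zero_of_mul_opH_free hY hZ, zero_mul]

/-- The equation for 𝓛 does not involve u and is solved first. Then τ solves the linear equation ∂τ
= τ φ, and u is defined by the ansatz. -/
theorem exists_isFlow {u₀ : LatFun K} {L₀ : Op K} (hL : OrdLE 1 L₀) (hf : L₀ ∈ freeRing K)
    (ha : Ansatz u₀ (L₀.val 1 0)) (j : ℕ) :
    ∃ u L, IsFlow j u₀ L₀ u L ∧ Ansatz u (L.val 1 0) := by
  obtain ⟨L, ho, hf, h1, h2⟩ := exists_formal_field hL hf j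
  obtain ⟨C, τ, hC, t1, t2⟩ := ansatz_iff.1 ha
  obtain ⟨φ, p1, p2⟩ := exists_tau_logDer j L.val
  choose θ q1 q2 using fun n m => exists_formal_linear (φ n m) (τ n m : K)
  have hu : ∀ n m, IsUnit (θ n m) := fun n m => by
    rw [isUnit_iff_constantCoeff, q1]
    exact Units.isUnit _
  choose σ hσ using hu
  have f1 : (fun n m => Units.map (constantCoeff (R := K) : PowerSeries K →* K) (σ n m)) = τ := by
    funext n m
    ext
    show constantCoeff (σ n m : PowerSeries K) = _
    rw [hσ, q1]
  have f2 : ∀ n m, HasLogDer (RingHom.id (PowerSeries K)) (ddt K) (σ n m) (φ n m) := by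
    intro n m
    rw [HasLogDer, hσ, q2]
    rfl
  have c1 : constantCoeff (algebraMap ℂ (PowerSeries K) C) = algebraMap ℂ K C := by
    rw [PowerSeries.algebraMap_apply, constantCoeff_C]
  have c2 : ddt K (algebraMap ℂ (PowerSeries K) C) = 0 := by
    rw [PowerSeries.algebraMap_apply, ddt_apply, derivative_C]
  have hD := isDer_ddt K
  refine ⟨fun n m => algebraMap ℂ (PowerSeries K) C * (tauU σ n m : PowerSeries K), L,
    ⟨ho, hf, fun n m => ?_, h1, fun n m => ?_, h2⟩,
    ansatz_iff.2 ⟨C, σ, hC, fun n m => rfl, fun n m => ?_⟩⟩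
  · rw [map_mul, map_tauU, f1, c1, t1]
  · rw [hD.leibniz, c2, hasLogDer_tauU hD f2, p1]
    simp only [RingHom.id_apply]
    ring
  -- The coefficient v₀ and the τ-quotient satisfy the same linear equation with the same initial
  -- value.
  · refine formal_linear_unique
      (ψ := subCoeff j L.val (n + 1) m - subCoeff j L.val n m) ?_ ?_ ?_
    · rw [map_tauV, f1, ← t2, ← h1, opHom_apply]
    · rw [← opMap_apply, h2, field_top ho hf]
    · have := hasLogDer_tauV hD f2 n m
      rwa [HasLogDer, p2] at this

theorem isTrajectory_iff {u₀ : LatFun K} {L₀ e₀ : Op K} (h₀ : IsPoint u₀ L₀ e₀) {j : ℕ}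
    {X : PDO (PowerSeries K) × PDO (PowerSeries K)} :
    IsTrajectory j ((opH u₀).val, L₀.val) X ↔ ∃ u L, X = ((opH u).val, L.val) ∧
      IsFlow j u₀ L₀ u L ∧ Ansatz u (L.val 1 0) := by
  have hder : ∀ u : LatFun (PowerSeries K), PDO.map (PowerSeries.derivative K) (opH u).val =
      (-(fn (fun n m => ddt K (u n m)) * (T₁ - T₂))).val := fun u => by
    rw [← opMap_opH (isDer_ddt K)]
    rfl
  constructor
  · rintro ⟨h1, h2, h3, h4⟩
    obtain ⟨u, L, e, rfl, hp, ha⟩ := mem_NVSpace_iff.1 h1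
    refine ⟨u, L, rfl, ?_, ha⟩
    have h2' : opHom (constantCoeff (R := K)) (opH u) = opH u₀ := ext h2
    rw [opHom_opH] at h2'
    rw [hder] at h4
    obtain ⟨h5, h6⟩ := eq_of_satisfiesEq ha.isUnit hp h4
    exact ⟨hp.ord, hp.free, fun n m => congrFun (congrFun (opH_injective h2') n) m, ext h3,
      fun n m => congrFun (congrFun h5 n) m, ext h6⟩
  · rintro ⟨u, L, rfl, h, ha⟩
    have hp := h.isPoint h₀
    refine ⟨mem_NVSpace_iff.2 ⟨u, L, _, rfl, hp, ha⟩, ?_, congrArg val h.init_L, ?_⟩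
    · have : opHom (constantCoeff (R := K)) (opH u) = opH u₀ := by
        rw [opHom_opH]
        simp only [h.init_u]
      exact congrArg val this
    · have h5 := satisfiesEq hp j
      have h6 : PDO.map (PowerSeries.derivative K) L.val = (field j L).val := congrArg val h.eq_L
      rw [hder, h6]
      simp only [h.eq_u]
      exact h5

end Op

variable {K : Type*} [CommRing K] [Algebra ℂ K]

theorem existsUnique_isTrajectory {x : PDO K × PDO K} (hx : x ∈ NVSpace K) (j : ℕ) :
    ∃! X : PDO (PowerSeries K) × PDO (PowerSeries K), IsTrajectory j x X := by
  obtain ⟨u₀, L₀, e₀, rfl, h₀, ha⟩ := mem_NVSpace_iff.1 hx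
  obtain ⟨u, L, hF, hA⟩ := exists_isFlow h₀.ord h₀.free ha j
  refine ⟨_, (isTrajectory_iff h₀).2 ⟨u, L, rfl, hF, hA⟩, fun Y hY => ?_⟩
  obtain ⟨u', L', rfl, hF', -⟩ := (isTrajectory_iff h₀).1 hY
  obtain ⟨rfl, rfl⟩ := hF.unique hF'
  rfl

end
end DiscreteNV

namespace DiscreteNV

noncomputable section

open PDO Op PowerSeries

/-! ### Commuting flows -/

section swap

variable {K : Type*} [CommRing K]

/-- The derivation `d/ds` of `K⟦s⟧⟦t⟧`. -/
def dds (K : Type*) [CommRing K] : PowerSeries (PowerSeries K) →+ PowerSeries (PowerSeries K) where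
  toFun f := PowerSeries.mk fun b => ddt K (coeff b f)
  map_zero' := by ext b; simp
  map_add' f g := by ext b; simp

theorem coeff_dds (f : PowerSeries (PowerSeries K)) (b : ℕ) :
    coeff b (dds K f) = ddt K (coeff b f) := by
  show coeff b (PowerSeries.mk fun b => ddt K (coeff b f)) = _
  rw [coeff_mk]

theorem isDer_dds (K : Type*) [CommRing K] :
    IsDer (RingHom.id (PowerSeries (PowerSeries K))) (dds K) where
  leibniz f g := by
    refine PowerSeries.ext fun b => ?_
    simp only [RingHom.id_apply, coeff_dds, coeff_mul, map_add, map_sum, (isDer_ddt K).leibniz,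
      Finset.sum_add_distrib]

theorem constantCoeff_dds (f : PowerSeries (PowerSeries K)) :
    constantCoeff (dds K f) = ddt K (constantCoeff f) := by
  rw [← coeff_zero_eq_constantCoeff_apply, ← coeff_zero_eq_constantCoeff_apply, coeff_dds]

theorem ddt_dds (f : PowerSeries (PowerSeries K)) :
    ddt (PowerSeries K) (dds K f) = dds K (ddt (PowerSeries K) f) := by
  refine PowerSeries.ext fun b => PowerSeries.ext fun a => ?_
  have h : ((b : PowerSeries K) + 1) = C ((b : K) + 1) := by simp
  rw [coeff_ddt, coeff_dds, coeff_dds, coeff_ddt, coeff_ddt, h, coeff_mul_C, coeff_mul_C, coeff_ddt]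
  ring

/-- The isomorphism `K⟦s⟧⟦t⟧ → K⟦t⟧⟦s⟧`. -/
def swap (K : Type*) [CommRing K] :
    PowerSeries (PowerSeries K) →+* PowerSeries (PowerSeries K) where
  toFun f := PowerSeries.mk fun a => PowerSeries.mk fun b => coeff a (coeff b f)
  map_zero' := by
    refine PowerSeries.ext fun a => PowerSeries.ext fun b => ?_
    simp
  map_one' := by
    refine PowerSeries.ext fun a => PowerSeries.ext fun b => ?_
    rw [coeff_mk, coeff_mk, coeff_one, coeff_one]
    by_cases ha : a = 0 <;> by_cases hb : b = 0 <;> simp [ha, hb, coeff_one]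
  map_add' f g := by
    refine PowerSeries.ext fun a => PowerSeries.ext fun b => ?_
    simp
  map_mul' f g := by
    refine PowerSeries.ext fun a => PowerSeries.ext fun b => ?_
    simp only [coeff_mk, coeff_mul, map_sum]
    exact Finset.sum_comm

theorem coeff_swap (f : PowerSeries (PowerSeries K)) (a b : ℕ) :
    coeff b (coeff a (swap K f)) = coeff a (coeff b f) := by
  show coeff b (coeff a (PowerSeries.mk fun a => PowerSeries.mk fun b => coeff a (coeff b f))) = _
  rw [coeff_mk, coeff_mk]

theorem ddt_swap (f : PowerSeries (PowerSeries K)) :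
    ddt (PowerSeries K) (swap K f) = swap K (dds K f) := by
  refine PowerSeries.ext fun a => PowerSeries.ext fun b => ?_
  have h : ((a : PowerSeries K) + 1) = C ((a : K) + 1) := by simp
  rw [coeff_ddt, h, coeff_mul_C, coeff_swap, coeff_swap, coeff_dds, coeff_ddt]

theorem constantCoeff_swap (f : PowerSeries (PowerSeries K)) :
    constantCoeff (swap K f) = PowerSeries.map (constantCoeff (R := K)) f := by
  ext b
  rw [← coeff_zero_eq_constantCoeff_apply, coeff_swap, coeff_map,
    coeff_zero_eq_constantCoeff_apply]

theorem ddt_map {R R' : Type*} [CommRing R] [CommRing R'] (φ : R →+* R') (f : PowerSeries R) :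
    ddt R' (PowerSeries.map φ f) = PowerSeries.map φ (ddt R f) := by
  ext b
  rw [coeff_ddt, coeff_map, coeff_map, coeff_ddt]
  simp

theorem coeff₂_swap (a b : ℕ) (x : Op (PowerSeries (PowerSeries K))) :
    coeff₂ a b x.val = coeff₂ b a (opHom (swap K) x).val := by
  funext i j n m
  exact (coeff_swap _ _ _).symm

end swap

/-! ### Two times: the second flow carries solutions of the first to solutions -/

namespace Op

variable {K : Type*} [CommRing K] [Algebra ℂ K] {i j : ℕ} {u₀ : LatFun K} {L₀ : Op K}
  {u : LatFun (PowerSeries K)} {L : Op (PowerSeries K)}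
  {w : LatFun (PowerSeries (PowerSeries K))} {M : Op (PowerSeries (PowerSeries K))}

/-- The i-th equation in s holds at t = 0. If its defect vanishes modulo t^k, commutation of the
fields makes the t-derivative of the defect vanish modulo t^k. -/
theorem IsFlow.opMap_dds (h : IsFlow i u₀ L₀ u L) (h' : IsFlow j u L w M) :
    opMap (dds K) M = field i M := by
  rw [← sub_eq_zero]
  refine formal_op_eq_zero ?_ fun k hk => ?_
  · have : opHom (constantCoeff (R := PowerSeries K)) (opMap (dds K) M) =
        opMap (ddt K) (opHom (constantCoeff (R := PowerSeries K)) M) := by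
      ext i j n m : 5
      exact constantCoeff_dds _
    rw [map_sub, this, opHom_field _ h'.ord h'.free, h'.init_L, h.eq_L, sub_self]
  · rw [map_sub, sub_eq_zero, opHom_field _ h'.ord h'.free] at hk
    have hd := (isDer_dds K).comp (modX (PowerSeries K) k)
    have hd' := isDer_ddtMod (K := PowerSeries K) k
    have e1 : opMap (ddt (PowerSeries K)) (opMap (dds K) M) =
        opMap (dds K) (opMap (ddt (PowerSeries K)) M) := by
      ext i j n m : 5
      exact ddt_dds _
    have e2 := opMap_field_comm (i := i) (j := j) hd hd' h'.ord h'.free h'.ord h'.free rfl hk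
      (by rw [opMap_ddtMod, h'.eq_L, opHom_field _ h'.ord h'.free]; rfl)
    rw [map_sub, ← e2, opMap_ddtMod, e1, h'.eq_L]
    exact sub_self _

/-- By ∂_s g_j = ∂_t g_i, at the level of logarithmic derivatives, the defect solves a homogeneous
linear equation in t and is zero at t = 0. -/
theorem IsFlow.dds_u (h : IsFlow i u₀ L₀ u L) (h' : IsFlow j u L w M) (n m : ℤ) :
    dds K (w n m) = w n m * logDer i M.val n m := by
  have hd := isDer_dds K
  have hd' := isDer_ddt (PowerSeries K)
  have hM := h.opMap_dds h'
  have hc := logDer_comm (i := i) (j := j) hd hd' h'.ord h'.free h'.ord h'.free rfl hM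
    h'.eq_L n m
  have h0 : dds K (w n m) - w n m * logDer i M.val n m = 0 := by
    refine formal_linear_unique (ψ := logDer j M.val n m) ?_ ?_ ?_
    · have := logDer_opHom (constantCoeff (R := PowerSeries K)) h'.ord h'.free i n m
      rw [h'.init_L] at this
      rw [map_sub, map_mul, constantCoeff_dds, ← this, h'.init_u, h.eq_u, sub_self, map_zero]
    · rw [map_sub, ddt_dds, hd'.leibniz, h'.eq_u, hd.leibniz, ← hc]
      simp only [RingHom.id_apply]
      ring
    · rw [map_zero, zero_mul]
  exact sub_eq_zero.1 h0

/-- The flow in the other order. -/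
theorem IsFlow.swap (h : IsFlow i u₀ L₀ u L) (h' : IsFlow j u L w M) :
    ∃ u' L', IsFlow j u₀ L₀ u' L' ∧
      IsFlow i u' L' (fun n m => swap K (w n m)) (opHom (swap K) M) := by
  -- This is restriction to s = 0; it gives the j-th flow of the initial point, which becomes the
  -- start of the i-th flow after the times are exchanged.
  set ρ := PowerSeries.map (constantCoeff (R := K)) with hρ
  have h0 : ∀ f : PowerSeries (PowerSeries K), constantCoeff (ρ f) =
      constantCoeff (constantCoeff f) := by
    intro f
    rw [← coeff_zero_eq_constantCoeff_apply, hρ, coeff_map, coeff_zero_eq_constantCoeff_apply]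
  refine ⟨fun n m => ρ (w n m), opHom ρ M,
    ⟨h'.ord.opHom ρ, opHom_free h'.free, fun n m => ?_, ?_, fun n m => ?_, ?_⟩,
    ⟨h'.ord.opHom _, opHom_free h'.free, fun n m => constantCoeff_swap _, ?_, fun n m => ?_, ?_⟩⟩
  · rw [h0, h'.init_u, h.init_u]
  · rw [← h.init_L, ← h'.init_L]
    ext i j n m : 5
    exact h0 _
  · rw [hρ, ddt_map, ← hρ, h'.eq_u, map_mul, logDer_opHom ρ h'.ord h'.free]
  · rw [← opHom_field ρ h'.ord h'.free, ← h'.eq_L]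
    ext i j n m : 5
    exact ddt_map (constantCoeff (R := K)) _
  · ext i j n m : 5
    exact constantCoeff_swap _
  · rw [ddt_swap, h.dds_u h', map_mul, logDer_opHom _ h'.ord h'.free]
  · rw [← opHom_field _ h'.ord h'.free, ← h.opMap_dds h']
    ext i j n m : 5
    exact ddt_swap _

end Op

variable {K : Type*} [CommRing K] [Algebra ℂ K]

theorem isTrajectory_comm {x : PDO K × PDO K} (hx : x ∈ NVSpace K) {i j : ℕ}
    {X Y : PDO (PowerSeries K) × PDO (PowerSeries K)} (hX : IsTrajectory i x X)
    (hY : IsTrajectory j x Y)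
    {X' Y' : PDO (PowerSeries (PowerSeries K)) × PDO (PowerSeries (PowerSeries K))}
    (hX' : IsTrajectory j X X') (hY' : IsTrajectory i Y Y') (a b : ℕ) :
    coeff₂ a b X'.1 = coeff₂ b a Y'.1 ∧ coeff₂ a b X'.2 = coeff₂ b a Y'.2 := by
  obtain ⟨u₀, L₀, e₀, rfl, h₀, ha⟩ := mem_NVSpace_iff.1 hx
  obtain ⟨u, L, rfl, hF, -⟩ := (isTrajectory_iff h₀).1 hX
  obtain ⟨v, M, rfl, hG, -⟩ := (isTrajectory_iff h₀).1 hY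
  obtain ⟨u', L', rfl, hF', -⟩ := (isTrajectory_iff (hF.isPoint h₀)).1 hX'
  obtain ⟨v', M', rfl, hG', -⟩ := (isTrajectory_iff (hG.isPoint h₀)).1 hY'
  obtain ⟨v₁, M₁, k1, k2⟩ := hF.swap hF'
  -- Uniqueness first identifies the restriction to s = 0 with the given j-th trajectory; only then
  -- do the two i-th trajectories share their start.
  obtain ⟨rfl, rfl⟩ := hG.unique k1
  obtain ⟨rfl, rfl⟩ := hG'.unique k2
  refine ⟨?_, coeff₂_swap a b L'⟩
  have := coeff₂_swap a b (opH u')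
  rwa [opHom_opH] at this

end
end DiscreteNV

theorem mainTheorem4 (K : Type*) [CommRing K] [Algebra ℂ K] :
    -- the equations are well defined: they determine a vector field on the space
    (∀ x ∈ DiscreteNV.NVSpace K, ∀ j : ℕ, 1 ≤ j →
      ∃! ξ : DiscreteNV.PDO K × DiscreteNV.PDO K, DiscreteNV.IsField j x ξ) ∧
    -- the vector fields commute: the derivatives of each of them along the other one agree
    (∀ x ∈ DiscreteNV.NVSpace K, ∀ i j : ℕ, 1 ≤ i → 1 ≤ j →
      ∀ ξ η : DiscreteNV.PDO K × DiscreteNV.PDO K,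
      DiscreteNV.IsField i x ξ → DiscreteNV.IsField j x η →
      ∀ ξ' η' : DiscreteNV.PDO (DualNumber K) × DiscreteNV.PDO (DualNumber K),
      DiscreteNV.IsField i (DiscreteNV.pointEps x η) ξ' →
      DiscreteNV.IsField j (DiscreteNV.pointEps x ξ) η' →
      DiscreteNV.PDO.epsPart ξ'.1 = DiscreteNV.PDO.epsPart η'.1 ∧
      DiscreteNV.PDO.epsPart ξ'.2 = DiscreteNV.PDO.epsPart η'.2) ∧
    -- each of the vector fields has a unique (formal) flow on the space
    (∀ x ∈ DiscreteNV.NVSpace K, ∀ j : ℕ, 1 ≤ j →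
      ∃! X : DiscreteNV.PDO (PowerSeries K) × DiscreteNV.PDO (PowerSeries K),
        DiscreteNV.IsTrajectory j x X) ∧
    -- the flows commute: `j` for time `t` after `i` for time `s` is `i` for `s` after `j` for `t`
    (∀ x ∈ DiscreteNV.NVSpace K, ∀ i j : ℕ, 1 ≤ i → 1 ≤ j →
      ∀ X Y : DiscreteNV.PDO (PowerSeries K) × DiscreteNV.PDO (PowerSeries K),
      DiscreteNV.IsTrajectory i x X → DiscreteNV.IsTrajectory j x Y →
      ∀ X' Y' : DiscreteNV.PDO (PowerSeries (PowerSeries K)) ×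
          DiscreteNV.PDO (PowerSeries (PowerSeries K)),
      DiscreteNV.IsTrajectory j X X' → DiscreteNV.IsTrajectory i Y Y' →
      ∀ a b : ℕ,
        DiscreteNV.coeff₂ a b X'.1 = DiscreteNV.coeff₂ b a Y'.1 ∧
        DiscreteNV.coeff₂ a b X'.2 = DiscreteNV.coeff₂ b a Y'.2) :=
  ⟨fun _ hx j _ => DiscreteNV.existsUnique_isField hx j,
    fun _ hx _ _ _ _ _ _ hξ hη _ _ hξ' hη' => DiscreteNV.isField_comm hx hξ hη hξ' hη',
    fun _ hx j _ => DiscreteNV.existsUnique_isTrajectory hx j,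
    fun _ hx _ _ _ _ _ _ hX hY _ _ hX' hY' => DiscreteNV.isTrajectory_comm hx hX hY hX' hY'⟩
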